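/- For a permutation $\pi$ of $\mathbb N_+=\{1,2,\dots\}$ or of $[\ell]=\{1,\dots,\ell\}$, say that $\pi$ splits at $s$ if it maps $\{i : i\le s\}$ to itself; the components of $\pi$ are the intervals into which its splitting times divide the ground set. Let $p=(p_\ell)_{\ell\ge1}$ be a probability distribution on $\mathbb N_+$ with finite mean $\mu=\sum_\ell \ell p_\ell$, and for each $\ell$ let $Q_\ell$ be a probability distribution on the permutations of $[\ell]$. Let $\Pi$ be a positive recurrent regenerative random permutation of $\mathbb N_+$ with block length distribution $p$ and blocks governed by $(Q_\ell)$. That is, there are random lengths $T_0\in\{0,1,2,\dots\}$ and $Y_1,Y_2,\dots\in\mathbb N_+$ such that $Y_1,Y_2,\dots$ are i.i.d. with law $p$ and independent of $T_0$; almost surely $\Pi$ splits at every $T_k:=T_0+Y_1+\dots+Y_k$, $k\ge0$; and, conditionally given $T_0,Y_1,Y_2,\dots$, the reduced permutations $i\mapsto \Pi_{T_{k-1}+i}-T_{k-1}$ of $[Y_k]$, $k\ge 1$, are independent, the $k$-th having law $Q_{Y_k}$. (The permutation on the initial block $[T_0]$ is arbitrary.) The permutation $\Pi$ regenerates at $n$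 if $T_k=n$ for some $k\ge0$. Let $\mathrm{cyc}_n$ be the length of the cycle of $\Pi$ containing $n$, and $\mathrm{blk}_n$ the length of the block ($[1,T_0]$ or $(T_{k-1},T_k]$) containing $n$. Let $\nu_j=\sum_\ell p_\ell\,\mathbb E[\#\{\text{cycles of length } j \text{ of } \sigma_\ell\}]$, with $\sigma_\ell$ of law $Q_\ell$, be the expected number of cycles of length $j$ in a generic block, and let $L^*_\ell$ be the length of a size-biased cycle of $\sigma_\ell$, that is, of the cycle of $\sigma_\ell$ containing an independent uniform point of $[\ell]$. (i) Let $C_{n,j}$ be the number of cycles of $\Pi$ of length $j$ that are wholly contained in $[n]$. Almost surely $C_{n,j}/n\to \nu_j/\mu$ for every $j\ge1$, and $\mu=\sum_j j\nu_j$. The same limit holds if $C_{n,j}$ is replaced by the larger number of cycles of length $j$ whose least element is in $[n]$. (ii) If $p$ is aperiodic (the greatest common divisor of $\{\ell: p_\ell>0\}$ is $1$), then $$\lim_{n\to\infty}\mathbb P(\Pi\text{ regenerates at }n)=\frac1\mu,\qquad \lim_{n\to\infty}\mathbb P(\mathrm{cyc}_n=j)=\frac{j\nu_j}{\mu}\quad(j\ge1),$$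 $$\lim_{n\to\infty}\mathbb P(\mathrm{cyc}_n=j,\ \mathrm{blk}_n=\ell)=\frac{\ell p_\ell}{\mu}\,\mathbb P(L^*_\ell=j)\quad(1\le j\le\ell),$$ $$\lim_{n\to\infty}\mathbb P(\mathrm{cyc}_n=j)=\frac1\mu\sum_{\ell\ge1}\ell p_\ell\,\mathbb P(L^*_\ell=j)\quad(j\ge1).$$ (iii) If $p$ is aperiodic, then there is an almost sure limiting frequency $p^\circ_j$ of cycles of length $j$ relative to cycles of all lengths: almost surely, for every $j$, the ratio of the number of cycles of length $j$ in $[n]$ to the number of all cycles in $[n]$ converges to $p^\circ_j$ as $n\to\infty$, both when the cycles counted are those wholly contained in $[n]$ and when they are those whose least element is in $[n]$. These frequencies are $$p^\circ_j=\frac{\nu_j}{\sum_{i\ge1}\nu_i}\qquad(j\ge1),$$ and $(p^\circ_j)$ is the unique probability distribution on $\mathbb N_+$ that satisfies $$p^\circ_j=\frac{\mu^\circ}{\mu}\,\frac1j\sum_{\ell\ge1}\ell p_\ell\,\mathbb P(L^*_\ell=j)\quad(j\ge1),\qquad\text{where }\mu^\circ=\sum_{j\ge1} j p^\circ_j.$$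 (iv) Statements (i)-(iii) hold with cycles replaced by components throughout, that is, with $\nu_j$, $C_{n,j}$, $\mathrm{cyc}_n$, $L^*_\ell$ and $p^\circ_j$ replaced by the corresponding quantities for components of $\Pi$ and of the reduced block permutations. -/

import Mathlib

open MeasureTheory ProbabilityTheory Filter Topology
open scoped ENNReal

namespace RegenPerm

/-- The two ways of partitioning the ground set of a permutation. -/
inductive PartKind
  | cycle
  | component

/-- The cycle (orbit) of `σ` containing `a`. -/
def cycleAt {α : Type} (σ : Equiv.Perm α) (a : α) : Set α :=
  {b | σ.SameCycle a b}

/-- `σ` splits at `s`: it maps the initial interval ending at `s` to itself. -/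
def SplitsAt {α : Type} [LinearOrder α] (σ : Equiv.Perm α) (s : α) : Prop :=
  ∀ i, i ≤ s → σ i ≤ s

/-- The component of `σ` containing `a`: all points that no splitting time separates from `a`. -/
def componentAt {α : Type} [LinearOrder α] (σ : Equiv.Perm α) (a : α) : Set α :=
  {b | ∀ s, SplitsAt σ s → (b ≤ s ↔ a ≤ s)}

/-- The part (cycle or component) of `σ` containing `a`. -/
def partAt {α : Type} [LinearOrder α] (κ : PartKind) (σ : Equiv.Perm α) (a : α) : Set α :=
  match κ with
  | .cycle => cycleAt σ a
  | .component => componentAt σ a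

/-- The set of all parts (cycles, respectively components) of `σ`. -/
def parts {α : Type} [LinearOrder α] (κ : PartKind) (σ : Equiv.Perm α) : Set (Set α) :=
  Set.range (partAt κ σ)

/-- Number of parts of `π` of length `j` that are wholly contained in `[n]`. -/
noncomputable def insideCount (κ : PartKind) (π : Equiv.Perm ℕ+) (n j : ℕ+) : ℕ∞ :=
  {c ∈ parts κ π | c.encard = ((j : ℕ) : ℕ∞) ∧ c ⊆ Set.Iic n}.encard

/-- Number of parts of `π`, of all lengths, that are wholly contained in `[n]`. -/
noncomputable def insideTotal (κ : PartKind) (π : Equiv.Perm ℕ+) (n : ℕ+) : ℕ∞ :=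
  {c ∈ parts κ π | c ⊆ Set.Iic n}.encard

/-- Number of parts of `π` of length `j` whose least element is in `[n]`. -/
noncomputable def leastCount (κ : PartKind) (π : Equiv.Perm ℕ+) (n j : ℕ+) : ℕ∞ :=
  {c ∈ parts κ π | c.encard = ((j : ℕ) : ℕ∞) ∧ ∃ m ≤ n, IsLeast c m}.encard

/-- Number of parts of `π`, of all lengths, whose least element is in `[n]`. -/
noncomputable def leastTotal (κ : PartKind) (π : Equiv.Perm ℕ+) (n : ℕ+) : ℕ∞ :=
  {c ∈ parts κ π | ∃ m ≤ n, IsLeast c m}.encard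

/-- Number of parts of length `j` of a permutation `σ` of a finite block of length `ℓ`. -/
noncomputable def blockCount (κ : PartKind) {ℓ : ℕ} (σ : Equiv.Perm (Fin ℓ)) (j : ℕ+) : ℕ∞ :=
  {c ∈ parts κ σ | c.encard = ((j : ℕ) : ℕ∞)}.encard

/-- The mean `μ` of the block length distribution. -/
noncomputable def meanLength (p : PMF ℕ+) : ℝ≥0∞ :=
  ∑' ℓ : ℕ+, ((ℓ : ℕ) : ℝ≥0∞) * p ℓ

/-- The expected number `ν_j` of parts of length `j` in a generic block: the length `ℓ` of the block
has law `p` and, given `ℓ`, its reduced permutation has law `Q ℓ`. -/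
noncomputable def nu (κ : PartKind) (p : PMF ℕ+)
    (Q : ∀ ℓ : ℕ+, PMF (Equiv.Perm (Fin (ℓ : ℕ)))) (j : ℕ+) : ℝ≥0∞ :=
  ∑' ℓ : ℕ+, p ℓ * ∑ σ : Equiv.Perm (Fin (ℓ : ℕ)), Q ℓ σ * (blockCount κ σ j : ℝ≥0∞)

/-- The law of the length of a size-biased part of a random permutation of a block of length `ℓ`
with law `q`: the length of the part containing an independent uniform point. -/
noncomputable def sizeBiasedLength (κ : PartKind) {ℓ : ℕ+}
    (q : PMF (Equiv.Perm (Fin (ℓ : ℕ)))) : PMF ℕ∞ :=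
  q.bind fun σ => (PMF.uniformOfFintype (Fin (ℓ : ℕ))).map fun i => (partAt κ σ i).encard

/-- `p` is aperiodic: its support has greatest common divisor `1`. -/
def Aperiodic (p : PMF ℕ+) : Prop :=
  ∀ d : ℕ, (∀ ℓ : ℕ+, p ℓ ≠ 0 → d ∣ (ℓ : ℕ)) → d = 1

/-- The renewal times `T_k = T_0 + Y_1 + ⋯ + Y_k`; here `Y k` stands for `Y_{k+1}`. -/
def renewalTime {Ω : Type*} (T₀ : Ω → ℕ) (Y : ℕ → Ω → ℕ+) (k : ℕ) (ω : Ω) : ℕ :=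
  T₀ ω + ∑ i ∈ Finset.range k, (Y i ω : ℕ)

/-- The regeneration block containing `n`: all points that no renewal time separates from `n`. -/
def blockAt {Ω : Type*} (T₀ : Ω → ℕ) (Y : ℕ → Ω → ℕ+) (ω : Ω) (n : ℕ+) : Set ℕ+ :=
  {m | ∀ k, (m : ℕ) ≤ renewalTime T₀ Y k ω ↔ (n : ℕ) ≤ renewalTime T₀ Y k ω}

/-- The reduced permutation of `π` on the interval `{a + 1, …, a + ℓ}` is `σ`. Points of
`{1, …, ℓ}` are represented in `Fin ℓ = {0, …, ℓ - 1}` by subtracting one. -/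
def HasReducedBlock (π : Equiv.Perm ℕ+) (a : ℕ) {ℓ : ℕ} (σ : Equiv.Perm (Fin ℓ)) : Prop :=
  ∀ i : Fin ℓ, (π (Nat.succPNat (a + i)) : ℕ) = a + (σ i : ℕ) + 1

/-- `X` is a recurrent regenerative random permutation of `{1, 2, …}` with block length distribution
`p` and blocks governed by `Q`: it is the concatenation of a block of finite length `T₀` and of
blocks of lengths `Y 0, Y 1, …` that are i.i.d. with law `p` and independent of `T₀`, and, given the
block lengths, the reduced permutations of the blocks of lengths `Y 0, Y 1, …` are independent and
the one on a block of length `ℓ` has law `Q ℓ`. The permutation on the initial block is arbitrary. -/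
structure IsRecurrentRegenerative {Ω : Type*} [MeasurableSpace Ω] (P : Measure Ω)
    (X : Ω → Equiv.Perm ℕ+) (T₀ : Ω → ℕ) (Y : ℕ → Ω → ℕ+) (p : PMF ℕ+)
    (Q : ∀ ℓ : ℕ+, PMF (Equiv.Perm (Fin (ℓ : ℕ)))) : Prop where
  measurable_perm : ∀ i : ℕ+, Measurable fun ω => (X ω i : ℕ)
  measurable_delay : Measurable T₀
  measurable_length : ∀ k, Measurable fun ω => (Y k ω : ℕ)
  splits : ∀ᵐ ω ∂P, ∀ k, ∀ i : ℕ+,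
    (i : ℕ) ≤ renewalTime T₀ Y k ω → (X ω i : ℕ) ≤ renewalTime T₀ Y k ω
  indep_lengths : iIndepFun (fun k ω => (Y k ω : ℕ)) P
  indep_delay : IndepFun T₀ (fun ω k => (Y k ω : ℕ)) P
  length_law : ∀ k, ∀ ℓ : ℕ+, P {ω | Y k ω = ℓ} = p ℓ
  block_law : ∀ (m t : ℕ) (ℓ : Fin m → ℕ+) (σ : ∀ k : Fin m, Equiv.Perm (Fin (ℓ k : ℕ))),
    P {ω | T₀ ω = t ∧ ∀ k : Fin m, Y k ω = ℓ k ∧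
        HasReducedBlock (X ω) (renewalTime T₀ Y k ω) (σ k)} =
      P {ω | T₀ ω = t ∧ ∀ k : Fin m, Y k ω = ℓ k} * ∏ k : Fin m, Q (ℓ k) (σ k)

end RegenPerm

/-!
The permutation is the concatenation of an initial block and of independent blocks, each with law
`blockWeight p Q` (`measure_delay_blocks`, deduced from the hypothesis on finite-dimensional laws).
A part of the permutation that meets a block is a part of its reduced permutation
(`partAt_blockEmb`), so every statement reduces to one about the sequence of blocks.

*Limits in distribution.* Splitting an event about the block of `n` according to the position `m`
of `n` in that block gives `∑ m < n, u (n - 1 - m) * h m`, where `u a` is the probability of a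
renewal at `a` and `h m` is the probability that a generic block has a point with the required
property in position `m` (`measure_pointEvent`). The delayed sequence `u` satisfies the renewal
equation up to an error that tends to `0`, and `∑ m < n, u (n - 1 - m) * r m → 1`, where `r m` is
the probability of a block longer than `m`; these two facts give `u → 1 / μ` (`tendsto_renewal`). For
the proof, take an ultrafilter along which `u` tends to its largest (or smallest) cluster point `c`,
and let `v k` be the limit of `u (n - k)`. The renewal equation makes `v` harmonic, so `v = c` on
the semigroup generated by the block lengths, which contains all large integers by aperiodicity, and
the second fact becomes `c * μ = 1`. Dominated convergence then yields all limits in distribution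
(`tendsto_measure_pointEvent`).

*Almost sure frequencies.* Parts are counted through their least elements, the leaders. The number
of leaders up to a renewal time is, up to the contribution of the initial block, a sum of
independent identically distributed contributions of the blocks, to which the strong law of large
numbers applies. Both counts of the theorem lie between the number of leaders up to the last renewal
before `n` and that up to the next one, which determines their rates
(`tendsto_div_of_renewal_bounds`).

*Identities.* A block of length `ℓ` has `ℓ` points, of which `j` times the number of parts of length
`j` lie in parts of length `j` (`encard_partAt_encard_eq`). Taking expectations gives `μ = ∑ j ν_j`
and expresses the size-biased laws through `ν`; the last relation then says that the distribution is
proportional to `ν`.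
-/

namespace RegenPerm

/-! ### The renewal theorem for real sequences -/

/-- Dominated convergence for convolutions along an arbitrary filter: if the shifts of a bounded
sequence `u` converge along `l`, then so do its convolutions with a summable sequence. -/
lemma tendsto_convolution {u h : ℕ → ℝ} {l : Filter ℕ} (hl : l ≤ atTop)
    (hu0 : ∀ n, 0 ≤ u n) (hu1 : ∀ n, u n ≤ 1) (hh0 : ∀ n, 0 ≤ h n) (hh : Summable h)
    {v : ℕ → ℝ} (hv : ∀ k, Tendsto (fun n => u (n - k)) l (𝓝 (v k))) (k : ℕ) :
    Tendsto (fun n => ∑ m ∈ Finset.range (n - k), u (n - k - 1 - m) * h m) l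
      (𝓝 (∑' m, v (k + 1 + m) * h m)) := by
  have key : Tendsto (fun n => ∑' m, if m < n - k then u (n - k - 1 - m) * h m else 0) l
      (𝓝 (∑' m, v (k + 1 + m) * h m)) := by
    refine tendsto_tsum_of_dominated_convergence hh (fun m => ?_) ?_
    · refine ((hv (k + 1 + m)).mul_const (h m)).congr' ?_
      filter_upwards [hl (eventually_gt_atTop (k + m))] with n hn
      rw [if_pos (by omega)]
      congr 2
      omega
    · refine Eventually.of_forall fun n m => ?_
      split_ifs
      · rw [Real.norm_of_nonneg (mul_nonneg (hu0 _) (hh0 _))]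
        exact mul_le_of_le_one_left (hh0 _) (hu1 _)
      · simpa using hh0 m
  refine key.congr fun n => ?_
  rw [tsum_eq_sum (s := Finset.range (n - k)) (fun m hm => if_neg (by simpa using hm))]
  exact Finset.sum_congr rfl fun m hm => if_pos (by simpa using hm)

/-- Along an ultrafilter all shifts of a bounded sequence converge. -/
lemma exists_tendsto_shift {u : ℕ → ℝ} (hu0 : ∀ n, 0 ≤ u n) (hu1 : ∀ n, u n ≤ 1)
    (U : Ultrafilter ℕ) : ∃ v : ℕ → ℝ, ∀ k, Tendsto (fun n => u (n - k)) U (𝓝 (v k)) := by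
  have : ∀ k, ∃ x, Tendsto (fun n => u (n - k)) U (𝓝 x) := by
    intro k
    obtain ⟨x, -, hx⟩ := (isCompact_Icc (a := (0 : ℝ)) (b := 1)).ultrafilter_le_nhds'
      (U.map fun n => u (n - k)) (Ultrafilter.mem_map.2 (univ_mem' fun n => ⟨hu0 _, hu1 _⟩))
    exact ⟨x, hx⟩
  exact ⟨fun k => (this k).choose, fun k => (this k).choose_spec⟩

/-- An extremal cluster point of a renewal sequence is the reciprocal of the mean. The limits `v` of
the shifts of `u` along an ultrafilter realising the extremal value form a harmonic sequence, so `v`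
is constant on the additive semigroup generated by the step lengths, which contains all large
integers; the last-renewal identity then determines the constant. The sign of `s` decides between
largest and smallest cluster points. -/
lemma extremal_mapClusterPt_mul_tsum {u q r : ℕ → ℝ}
    (hu0 : ∀ n, 0 ≤ u n) (hu1 : ∀ n, u n ≤ 1)
    (hq0 : ∀ n, 0 ≤ q n) (hq : HasSum q 1) (hr0 : ∀ n, 0 ≤ r n) (hr : Summable r)
    (hrec : Tendsto (fun n => u n - ∑ m ∈ Finset.range n, u (n - 1 - m) * q m) atTop (𝓝 0))
    (hlast : Tendsto (fun n => ∑ m ∈ Finset.range n, u (n - 1 - m) * r m) atTop (𝓝 1))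
    (hgcd : Nat.setGcd {l | ∃ m, l = m + 1 ∧ q m ≠ 0} = 1)
    {c s : ℝ} (hs : s ≠ 0) (hc : MapClusterPt c atTop u)
    (hext : ∀ c', MapClusterPt c' atTop u → 0 ≤ s * (c - c')) :
    c * ∑' m, r m = 1 := by
  obtain ⟨U, hU, hUc⟩ := mapClusterPt_iff_ultrafilter.1 hc
  obtain ⟨v, hv⟩ := exists_tendsto_shift hu0 hu1 U
  have hv0 : v 0 = c := tendsto_nhds_unique (hv 0) (by simpa using hUc)
  have hsub : ∀ k, Tendsto (fun n : ℕ => n - k) U atTop := fun k =>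
    (tendsto_sub_atTop_nat k).mono_left hU
  have hvc : ∀ k, MapClusterPt (v k) atTop u := fun k =>
    MapClusterPt.of_comp (hsub k) (hv k).mapClusterPt
  have hharm : ∀ k, v k = ∑' m, v (k + 1 + m) * q m := by
    intro k
    have h1 := tendsto_convolution hU hu0 hu1 hq0 hq.summable hv k
    have h2 := (hv k).sub h1
    have h3 := hrec.comp (hsub k)
    exact sub_eq_zero.1 (tendsto_nhds_unique h2 h3)
  have hlastv : ∀ k, ∑' m, v (k + 1 + m) * r m = 1 := fun k =>
    tendsto_nhds_unique (tendsto_convolution hU hu0 hu1 hr0 hr hv k) (hlast.comp (hsub k))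
  have hvI : ∀ k, v k ∈ Set.Icc (0 : ℝ) 1 := fun k =>
    isClosed_Icc.mem_of_tendsto (hv k) (Eventually.of_forall fun n => ⟨hu0 _, hu1 _⟩)
  have hstep : ∀ k, v k = c → ∀ m, q m ≠ 0 → v (k + 1 + m) = c := by
    intro k hk m hm
    have hsum : Summable fun m => v (k + 1 + m) * q m :=
      Summable.of_nonneg_of_le (fun m => mul_nonneg (hvI _).1 (hq0 m))
        (fun m => mul_le_of_le_one_left (hq0 m) (hvI _).2) hq.summable
    -- an average of terms of one sign vanishes, hence so does each term
    have h0 : HasSum (fun m => s * (c - v (k + 1 + m)) * q m) 0 := by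
      have h1 := ((hq.mul_left c).sub hsum.hasSum).mul_left s
      rw [← hharm k, hk, mul_one, sub_self, mul_zero] at h1
      exact h1.congr_fun fun m => by ring
    have h1 := (hasSum_zero_iff_of_nonneg
      fun m => mul_nonneg (hext _ (hvc (k + 1 + m))) (hq0 m)).1 h0
    have h2 := congrFun h1 m
    simp only [Pi.zero_apply, mul_eq_zero, hm, hs, false_or, or_false] at h2
    linarith
  have hclos : ∀ l ∈ AddSubmonoid.closure {l | ∃ m, l = m + 1 ∧ q m ≠ 0},
      ∀ k, v k = c → v (k + l) = c := by
    intro l hl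
    induction hl using AddSubmonoid.closure_induction with
    | mem x hx =>
      obtain ⟨m, rfl, hm⟩ := hx
      intro k hk
      have := hstep k hk m hm
      rwa [add_assoc, add_comm 1 m] at this
    | zero => simp
    | add x y _ _ hx hy =>
      intro k hk
      rw [← add_assoc]
      exact hy _ (hx _ hk)
  obtain ⟨K, hK⟩ := Nat.exists_mem_closure_of_ge {l | ∃ m, l = m + 1 ∧ q m ≠ 0}
  have hlarge : ∀ l, K ≤ l → v l = c := by
    intro l hl
    simpa using hclos l (hK l hl (by rw [hgcd]; exact one_dvd _)) 0 hv0
  rw [← hlastv K, ← tsum_mul_left]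
  exact tsum_congr fun m => by rw [hlarge _ (by omega)]

/-- The Erdős–Feller–Pollard renewal theorem, for sequences satisfying the renewal equation up to a
vanishing error. Here `q m` is the probability of a step of length `m + 1` and `r m` that of a step
longer than `m`. -/
theorem tendsto_renewal {u q r : ℕ → ℝ} (hu0 : ∀ n, 0 ≤ u n) (hu1 : ∀ n, u n ≤ 1)
    (hq0 : ∀ n, 0 ≤ q n) (hq : HasSum q 1) (hr0 : ∀ n, 0 ≤ r n) (hr : Summable r)
    (hrec : Tendsto (fun n => u n - ∑ m ∈ Finset.range n, u (n - 1 - m) * q m) atTop (𝓝 0))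
    (hlast : Tendsto (fun n => ∑ m ∈ Finset.range n, u (n - 1 - m) * r m) atTop (𝓝 1))
    (hgcd : Nat.setGcd {l | ∃ m, l = m + 1 ∧ q m ≠ 0} = 1) :
    Tendsto u atTop (𝓝 (∑' m, r m)⁻¹) := by
  have hev : ∀ᶠ n in atTop, u n ∈ Set.Icc (0 : ℝ) 1 :=
    Eventually.of_forall fun n => ⟨hu0 n, hu1 n⟩
  set C : Set ℝ := {c | MapClusterPt c atTop u} with hCdef
  have hCcl : IsClosed C := isClosed_setOfPred_clusterPt
  have hCsub : C ⊆ Set.Icc 0 1 := fun c hc => isClosed_Icc.mem_of_mapClusterPt hc hev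
  have hCcpt : IsCompact C := isCompact_Icc.of_isClosed_subset hCcl hCsub
  have hCne : C.Nonempty := by
    obtain ⟨x, -, hx⟩ := (isCompact_Icc (a := (0 : ℝ)) (b := 1)).exists_mapClusterPt
      (f := atTop) (u := u) (by simpa using hev)
    exact ⟨x, hx⟩
  obtain ⟨M, hM, hMmax⟩ := hCcpt.exists_isGreatest hCne
  obtain ⟨m, hm, hmmin⟩ := hCcpt.exists_isLeast hCne
  have h1 := extremal_mapClusterPt_mul_tsum hu0 hu1 hq0 hq hr0 hr hrec hlast hgcd
    one_ne_zero hM (fun c' hc' => by have := hMmax hc'; linarith)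
  have h2 := extremal_mapClusterPt_mul_tsum hu0 hu1 hq0 hq hr0 hr hrec hlast hgcd
    (neg_ne_zero.2 one_ne_zero) hm (fun c' hc' => by have := hmmin hc'; linarith)
  have hM' := eq_inv_of_mul_eq_one_left h1
  have hm' := eq_inv_of_mul_eq_one_left h2
  refine isCompact_Icc.tendsto_nhds_of_unique_mapClusterPt hev fun x _ hx => ?_
  have := hMmax hx
  have := hmmin hx
  linarith

/-- The key renewal theorem for a sequence that converges. -/
lemma tendsto_convolution_of_tendsto {u h : ℕ → ℝ} {c : ℝ} (hu0 : ∀ n, 0 ≤ u n)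
    (hu1 : ∀ n, u n ≤ 1) (hh0 : ∀ n, 0 ≤ h n) (hh : Summable h) (hu : Tendsto u atTop (𝓝 c)) :
    Tendsto (fun n => ∑ m ∈ Finset.range n, u (n - 1 - m) * h m) atTop (𝓝 (c * ∑' m, h m)) := by
  simpa [tsum_mul_left] using tendsto_convolution le_rfl hu0 hu1 hh0 hh
    (v := fun _ => c) (fun k => hu.comp (tendsto_sub_atTop_nat k)) 0

/-! ### Inversion of a law of large numbers -/

/-- If a count `c` is, up to a bounded error, between the partial sums `S` taken at the last renewal
before `n` and at the following one, then its rate is the ratio of the rates of `S` and of the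
renewal times `T`. -/
lemma tendsto_div_of_renewal_bounds {T : ℕ → ℕ} {S c : ℕ → ℝ} {C μ ν : ℝ} (hT : StrictMono T)
    (hμ : 0 < μ) (hTk : Tendsto (fun k : ℕ => (T k : ℝ) / k) atTop (𝓝 μ))
    (hSk : Tendsto (fun k : ℕ => S k / k) atTop (𝓝 ν)) (hS0 : ∀ k, 0 ≤ S k) (hC : 0 ≤ C)
    (hlow : ∀ k n, T k ≤ n → S k ≤ c n)
    (hupp : ∀ k n, T k ≤ n → n < T (k + 1) → c n ≤ C + S (k + 1)) :
    Tendsto (fun n : ℕ => c n / n) atTop (𝓝 (ν / μ)) := by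
  have hshift : Tendsto (fun k : ℕ => (k : ℝ) / ((k + 1 : ℕ) : ℝ)) atTop (𝓝 1) := by
    simpa using tendsto_natCast_div_add_atTop (1 : ℝ)
  have hshift' : Tendsto (fun k : ℕ => ((k + 1 : ℕ) : ℝ) / (k : ℝ)) atTop (𝓝 1) := by
    have := hshift.inv₀ one_ne_zero
    simpa using this
  have hTk1 := hTk.comp (tendsto_add_atTop_nat 1)
  have hSk1 := hSk.comp (tendsto_add_atTop_nat 1)
  have hlow' : Tendsto (fun k : ℕ => S k / T (k + 1)) atTop (𝓝 (ν / μ)) := by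
    have h := (hSk.mul hshift).div hTk1 hμ.ne'
    rw [mul_one] at h
    refine h.congr' ?_
    filter_upwards [eventually_gt_atTop 0] with k hk
    have hk' : (k : ℝ) ≠ 0 := by positivity
    have hk1 : ((k + 1 : ℕ) : ℝ) ≠ 0 := by positivity
    simp only [Pi.div_apply, Function.comp]
    field_simp
  have hupp' : Tendsto (fun k : ℕ => (C + S (k + 1)) / T k) atTop (𝓝 (ν / μ)) := by
    have h0 : Tendsto (fun k : ℕ => C / (k : ℝ)) atTop (𝓝 0) :=
      tendsto_const_div_atTop_nhds_zero_nat C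
    have h := (h0.add (hSk1.mul hshift')).div hTk hμ.ne'
    rw [mul_one, zero_add] at h
    refine h.congr' ?_
    filter_upwards [eventually_gt_atTop 0] with k hk
    have hk' : (k : ℝ) ≠ 0 := by positivity
    have hk1 : ((k + 1 : ℕ) : ℝ) ≠ 0 := by positivity
    simp only [Pi.div_apply, Function.comp]
    field_simp
  -- `N n` is the index of the last renewal up to time `n`
  let N : ℕ → ℕ := fun n => Nat.findGreatest (fun k => T k ≤ n) n
  have hNle : ∀ n, T 0 ≤ n → T (N n) ≤ n := fun n hn =>
    Nat.findGreatest_spec (P := fun k => T k ≤ n) (Nat.zero_le n) hn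
  have hNlt : ∀ n, n < T (N n + 1) := by
    intro n
    by_contra! h
    have h1 : N n + 1 ≤ n := (hT.le_apply).trans h
    have := Nat.le_findGreatest (P := fun k => T k ≤ n) h1 h
    exact absurd this (by simp [N])
  have hN : Tendsto N atTop atTop := by
    refine tendsto_atTop.2 fun k => ?_
    filter_upwards [eventually_ge_atTop (T k)] with n hn
    exact Nat.le_findGreatest (hT.le_apply.trans hn) hn
  refine tendsto_of_tendsto_of_tendsto_of_le_of_le' (hlow'.comp hN) (hupp'.comp hN) ?_ ?_
  · filter_upwards [eventually_ge_atTop (T 0), eventually_gt_atTop 0] with n hn hn0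
    have hn0' : (0 : ℝ) < n := by exact_mod_cast hn0
    have h2 : (n : ℝ) ≤ T (N n + 1) := by exact_mod_cast (hNlt n).le
    exact div_le_div₀ ((hS0 _).trans (hlow _ _ (hNle n hn))) (hlow _ _ (hNle n hn)) hn0' h2
  · filter_upwards [eventually_ge_atTop (T 1)] with n hn
    have h0 : T 0 ≤ n := (hT (Nat.zero_lt_one)).le.trans hn
    have h1 : 1 ≤ N n := Nat.le_findGreatest (hT.le_apply.trans hn) hn
    have hpos : 0 < T (N n) := lt_of_lt_of_le h1 hT.le_apply
    exact div_le_div₀ (add_nonneg hC (hS0 _)) (hupp _ _ (hNle n h0) (hNlt n))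
      (by exact_mod_cast hpos) (by exact_mod_cast hNle n h0)

/-! ### Parts of a permutation and their least elements -/

section Parts

variable {α : Type} [LinearOrder α] {κ : PartKind} {σ : Equiv.Perm α} {a b : α}

lemma mem_partAt_self (κ : PartKind) (σ : Equiv.Perm α) (a : α) : a ∈ partAt κ σ a := by
  cases κ
  · exact Equiv.Perm.SameCycle.refl σ a
  · exact fun s _ => Iff.rfl

lemma partAt_eq_of_mem (h : b ∈ partAt κ σ a) : partAt κ σ b = partAt κ σ a := by
  cases κ
  · ext x
    exact ⟨fun hx => Equiv.Perm.SameCycle.trans h hx,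
      fun hx => Equiv.Perm.SameCycle.trans (Equiv.Perm.SameCycle.symm h) hx⟩
  · ext x
    exact ⟨fun hx s hs => (hx s hs).trans (h s hs), fun hx s hs => (hx s hs).trans (h s hs).symm⟩

/-- The least elements of the parts of `σ` whose length is in `A`. -/
def leaders (κ : PartKind) (σ : Equiv.Perm α) (A : Set ℕ∞) : Set α :=
  {m | IsLeast (partAt κ σ m) m ∧ (partAt κ σ m).encard ∈ A}

/-- Parts correspond bijectively to their least elements. -/
lemma encard_parts_isLeast_mem (κ : PartKind) (σ : Equiv.Perm α) (A : Set ℕ∞) (D : Set α) :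
    {c ∈ parts κ σ | c.encard ∈ A ∧ ∃ m ∈ D, IsLeast c m}.encard = (D ∩ leaders κ σ A).encard := by
  have hinj : Set.InjOn (partAt κ σ) (D ∩ leaders κ σ A) := by
    intro x hx y hy hxy
    have h := hx.2.1
    rw [hxy] at h
    exact h.unique hy.2.1
  rw [← hinj.encard_image]
  congr 1
  ext c
  constructor
  · rintro ⟨⟨x, rfl⟩, hA, m, hD, hm⟩
    have h := partAt_eq_of_mem hm.1
    exact ⟨m, ⟨hD, by rwa [h], by rwa [h]⟩, h⟩
  · rintro ⟨m, ⟨hD, hm, hA⟩, rfl⟩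
    exact ⟨⟨m, rfl⟩, hA, m, hD, hm⟩

lemma exists_isLeast_partAt [WellFoundedLT α] (κ : PartKind) (σ : Equiv.Perm α) (a : α) :
    ∃ m, IsLeast (partAt κ σ a) m :=
  ⟨_, WellFounded.min_mem wellFounded_lt _ ⟨a, mem_partAt_self κ σ a⟩,
    fun _ hx => WellFounded.min_le wellFounded_lt hx⟩

end Parts

section Finite

variable {ℓ : ℕ} (κ : PartKind) (σ : Equiv.Perm (Fin ℓ))

lemma blockCount_eq_encard_leaders (j : ℕ+) :
    blockCount κ σ j = (leaders κ σ {((j : ℕ) : ℕ∞)}).encard := by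
  have := encard_parts_isLeast_mem κ σ {((j : ℕ) : ℕ∞)} Set.univ
  rw [Set.univ_inter] at this
  rw [← this, blockCount]
  congr 1
  ext c
  constructor
  · rintro ⟨⟨x, rfl⟩, h⟩
    obtain ⟨m, hm⟩ := exists_isLeast_partAt κ σ x
    exact ⟨⟨x, rfl⟩, h, m, trivial, hm⟩
  · rintro ⟨h1, h2, -⟩
    exact ⟨h1, h2⟩

/-- The parts of length `j` partition the set of points that lie in a part of length `j`. -/
lemma encard_partAt_encard_eq (j : ℕ+) :
    {i | (partAt κ σ i).encard = ((j : ℕ) : ℕ∞)}.encard = ((j : ℕ) : ℕ∞) * blockCount κ σ j := by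
  classical
  rw [blockCount_eq_encard_leaders]
  choose g hg using exists_isLeast_partAt κ σ
  have hgpart : ∀ i, partAt κ σ (g i) = partAt κ σ i := fun i => partAt_eq_of_mem (hg i).1
  have hmaps : Set.MapsTo g
      ((Finset.univ.filter fun i => (partAt κ σ i).encard = ((j : ℕ) : ℕ∞) :
        Finset (Fin ℓ)) : Set _)
      ((Finset.univ.filter fun i => i ∈ leaders κ σ {((j : ℕ) : ℕ∞)} :
        Finset (Fin ℓ)) : Set _) := by
    intro i hi
    simp only [Finset.coe_filter, Finset.mem_univ, true_and, Set.mem_ofPred_eq] at hi ⊢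
    exact ⟨by rw [hgpart]; exact hg i, by rw [hgpart]; exact hi⟩
  have hcard := Finset.card_eq_sum_card_fiberwise hmaps
  have hfib : ∀ m ∈ (Finset.univ.filter fun i => i ∈ leaders κ σ {((j : ℕ) : ℕ∞)}),
      ((Finset.univ.filter fun i => (partAt κ σ i).encard = ((j : ℕ) : ℕ∞)).filter
        fun i => g i = m).card = j := by
    intro m hm
    simp only [Finset.mem_filter, Finset.mem_univ, true_and] at hm
    have hset : (((Finset.univ.filter fun i => (partAt κ σ i).encard = ((j : ℕ) : ℕ∞)).filter
        fun i => g i = m : Finset (Fin ℓ)) : Set (Fin ℓ)) = partAt κ σ m := by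
      ext i
      simp only [Finset.coe_filter, Finset.mem_filter, Finset.mem_univ, true_and,
        Set.mem_ofPred_eq]
      constructor
      · rintro ⟨-, rfl⟩
        rw [hgpart]
        exact mem_partAt_self κ σ i
      · intro hi
        have h := partAt_eq_of_mem hi
        refine ⟨by rw [h]; exact hm.2, ?_⟩
        have h1 := hg i
        rw [h] at h1
        exact h1.unique hm.1
    have h2 : (partAt κ σ m).encard = ((j : ℕ) : ℕ∞) := hm.2
    rw [← hset, Set.encard_coe_eq_coe_finsetCard] at h2
    exact_mod_cast h2
  rw [Finset.sum_congr rfl hfib, Finset.sum_const, smul_eq_mul] at hcard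
  have e1 : {i | (partAt κ σ i).encard = ((j : ℕ) : ℕ∞)} =
      ((Finset.univ.filter fun i => (partAt κ σ i).encard = ((j : ℕ) : ℕ∞) :
        Finset (Fin ℓ)) : Set (Fin ℓ)) := by ext; simp
  have e2 : leaders κ σ {((j : ℕ) : ℕ∞)} =
      ((Finset.univ.filter fun i => i ∈ leaders κ σ {((j : ℕ) : ℕ∞)} :
        Finset (Fin ℓ)) : Set (Fin ℓ)) := by ext; simp
  rw [e1, e2, Set.encard_coe_eq_coe_finsetCard, Set.encard_coe_eq_coe_finsetCard, ← Nat.cast_mul,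
    hcard, mul_comm]

end Finite

/-! ### Restriction of a permutation to a block -/

/-- The interval `{a + 1, …, a + ℓ}` as the image of `Fin ℓ`. -/
def blockEmb (a : ℕ) {ℓ : ℕ} (i : Fin ℓ) : ℕ+ := Nat.succPNat (a + i)

@[simp] lemma blockEmb_val (a : ℕ) {ℓ : ℕ} (i : Fin ℓ) : (blockEmb a i : ℕ) = a + i + 1 := rfl

lemma blockEmb_injective (a ℓ : ℕ) : Function.Injective (blockEmb a : Fin ℓ → ℕ+) := by
  intro i k h
  have := congrArg PNat.val h
  simp only [blockEmb_val] at this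
  exact Fin.ext (by simpa using this)

lemma blockEmb_le_blockEmb {a ℓ : ℕ} {i k : Fin ℓ} : blockEmb a i ≤ blockEmb a k ↔ i ≤ k := by
  rw [← PNat.coe_le_coe, blockEmb_val, blockEmb_val, Fin.le_def]
  omega

lemma exists_blockEmb_eq {a ℓ : ℕ} {x : ℕ+} (h1 : a < x) (h2 : (x : ℕ) ≤ a + ℓ) :
    ∃ i : Fin ℓ, blockEmb a i = x :=
  ⟨⟨x - a - 1, by omega⟩, PNat.coe_injective (by simp only [blockEmb_val]; omega)⟩

/-- `π` splits at the natural number `a`, where `a = 0` is allowed. -/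
def SplitsNat (π : Equiv.Perm ℕ+) (a : ℕ) : Prop := ∀ i : ℕ+, (i : ℕ) ≤ a → (π i : ℕ) ≤ a

section Block

variable {π : Equiv.Perm ℕ+} {a ℓ : ℕ} {σ : Equiv.Perm (Fin ℓ)}

/-- A permutation that splits at `a` also preserves the complement of `{1, …, a}`, because an
injective self-map of a finite set is onto. -/
lemma SplitsNat.lt_apply (h : SplitsNat π a) {x : ℕ+} (hx : a < x) : a < π x := by
  by_contra! hle
  have hfin : {i : ℕ+ | (i : ℕ) ≤ a}.Finite :=
    Set.Finite.preimage PNat.coe_injective.injOn (Set.finite_Iic a)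
  have hmaps : Set.MapsTo π {i : ℕ+ | (i : ℕ) ≤ a} {i : ℕ+ | (i : ℕ) ≤ a} := fun i hi => h i hi
  have hsurj := ((hfin.injOn_iff_bijOn_of_mapsTo hmaps).1 π.injective.injOn).surjOn
  obtain ⟨y, hy, hxy⟩ := hsurj hle
  rw [π.injective hxy] at hy
  exact absurd hx (not_lt.2 hy)

lemma HasReducedBlock.apply_blockEmb (h : HasReducedBlock π a σ) (i : Fin ℓ) :
    π (blockEmb a i) = blockEmb a (σ i) := PNat.coe_injective (h i)

lemma HasReducedBlock.unique {τ : Equiv.Perm (Fin ℓ)} (h : HasReducedBlock π a σ)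
    (h' : HasReducedBlock π a τ) : σ = τ := by
  ext1 i
  exact blockEmb_injective a ℓ ((h.apply_blockEmb i).symm.trans (h'.apply_blockEmb i))

lemma exists_hasReducedBlock (h : SplitsNat π a) (h' : SplitsNat π (a + ℓ)) :
    ∃ σ : Equiv.Perm (Fin ℓ), HasReducedBlock π a σ := by
  have : ∀ i : Fin ℓ, ∃ k : Fin ℓ, blockEmb a k = π (blockEmb a i) := fun i =>
    exists_blockEmb_eq (h.lt_apply (by simp only [blockEmb_val]; omega))
      (h' _ (by simp only [blockEmb_val]; omega))
  choose g hg using this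
  have hinj : Function.Injective g := fun i k hik =>
    blockEmb_injective a ℓ (π.injective (by rw [← hg, ← hg, hik]))
  refine ⟨Equiv.ofBijective g (Finite.injective_iff_bijective.1 hinj), fun i => ?_⟩
  exact (congrArg PNat.val (hg i)).symm

lemma HasReducedBlock.zpow_apply_blockEmb (h : HasReducedBlock π a σ) (z : ℤ) (i : Fin ℓ) :
    (π ^ z) (blockEmb a i) = blockEmb a ((σ ^ z) i) := by
  have hpow : ∀ (n : ℕ) (i : Fin ℓ), (π ^ n) (blockEmb a i) = blockEmb a ((σ ^ n) i) := by
    intro n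
    induction n with
    | zero => simp
    | succ n ih =>
      intro i
      rw [pow_succ, pow_succ, Equiv.Perm.mul_apply, Equiv.Perm.mul_apply, h.apply_blockEmb, ih]
  obtain ⟨n, rfl | rfl⟩ := z.eq_nat_or_neg
  · simpa using hpow n i
  · rw [zpow_neg, zpow_natCast, zpow_neg, zpow_natCast, Equiv.Perm.inv_eq_iff_eq, hpow,
      Equiv.Perm.coe_inv, Equiv.apply_symm_apply]

/-- The parts of `π` inside a block that `π` preserves are those of the reduced permutation. -/
lemma partAt_blockEmb (κ : PartKind) (h : HasReducedBlock π a σ) (ha : SplitsNat π a)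
    (hal : SplitsNat π (a + ℓ)) (i : Fin ℓ) :
    partAt κ π (blockEmb a i) = blockEmb a '' partAt κ σ i := by
  cases κ
  · ext x
    constructor
    · rintro ⟨z, hz⟩
      exact ⟨(σ ^ z) i, ⟨z, rfl⟩, by rw [← hz, h.zpow_apply_blockEmb]⟩
    · rintro ⟨_, ⟨z, rfl⟩, rfl⟩
      exact ⟨z, h.zpow_apply_blockEmb z i⟩
  · ext x
    constructor
    · intro hx
      have hlt : a < x := by
        rcases Nat.eq_zero_or_pos a with h0 | h0
        · rw [h0]; exact x.pos
        · have := hx ⟨a, h0⟩ (fun y hy => ha y hy)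
          by_contra! hle
          have h1 : (blockEmb a i : ℕ) ≤ a := this.1 hle
          simp only [blockEmb_val] at h1
          omega
      have hle : (x : ℕ) ≤ a + ℓ :=
        (hx ⟨a + ℓ, by have := i.pos; omega⟩ (fun y hy => hal y hy)).2
          (show a + (i : ℕ) + 1 ≤ a + ℓ by omega)
      obtain ⟨k, rfl⟩ := exists_blockEmb_eq hlt hle
      refine ⟨k, fun s hs => ?_, rfl⟩
      have hs' : SplitsAt π (blockEmb a s) := by
        intro y hy
        rcases le_or_gt (y : ℕ) a with hya | hya
        · rw [← PNat.coe_le_coe, blockEmb_val]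
          have := ha y hya
          omega
        · obtain ⟨t, rfl⟩ := exists_blockEmb_eq (ℓ := ℓ) hya
            (by rw [← PNat.coe_le_coe, blockEmb_val] at hy; omega)
          rw [h.apply_blockEmb, blockEmb_le_blockEmb]
          exact hs t (blockEmb_le_blockEmb.1 hy)
      simpa only [blockEmb_le_blockEmb] using hx _ hs'
    · rintro ⟨k, hk, rfl⟩ s hs
      rcases le_or_gt (s : ℕ) a with hsa | hsa
      · rw [← PNat.coe_le_coe, ← PNat.coe_le_coe, blockEmb_val, blockEmb_val]
        omega
      rcases le_or_gt (s : ℕ) (a + ℓ) with hsl | hsl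
      · obtain ⟨t, rfl⟩ := exists_blockEmb_eq hsa hsl
        rw [blockEmb_le_blockEmb, blockEmb_le_blockEmb]
        refine hk t fun y hy => ?_
        have := hs (blockEmb a y) (blockEmb_le_blockEmb.2 hy)
        rwa [h.apply_blockEmb, blockEmb_le_blockEmb] at this
      · rw [← PNat.coe_le_coe, ← PNat.coe_le_coe, blockEmb_val, blockEmb_val]
        omega

lemma encard_partAt_blockEmb (κ : PartKind) (h : HasReducedBlock π a σ) (ha : SplitsNat π a)
    (hal : SplitsNat π (a + ℓ)) (i : Fin ℓ) :
    (partAt κ π (blockEmb a i)).encard = (partAt κ σ i).encard := by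
  rw [partAt_blockEmb κ h ha hal, (blockEmb_injective a ℓ).encard_image]

lemma blockEmb_mem_leaders (κ : PartKind) (h : HasReducedBlock π a σ) (ha : SplitsNat π a)
    (hal : SplitsNat π (a + ℓ)) (A : Set ℕ∞) (i : Fin ℓ) :
    blockEmb a i ∈ leaders κ π A ↔ i ∈ leaders κ σ A := by
  simp only [leaders, Set.mem_ofPred_eq, encard_partAt_blockEmb κ h ha hal]
  refine and_congr_left fun _ => ?_
  rw [partAt_blockEmb κ h ha hal]
  constructor
  · intro hi
    exact ⟨mem_partAt_self κ σ i, fun k hk => blockEmb_le_blockEmb.1 (hi.2 ⟨k, hk, rfl⟩)⟩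
  · intro hi
    refine ⟨⟨i, hi.1, rfl⟩, ?_⟩
    rintro _ ⟨k, hk, rfl⟩
    exact blockEmb_le_blockEmb.2 (hi.2 hk)

/-- The number of parts of `π` with length in `A` and least element at most `t`. -/
noncomputable def leaderCount (κ : PartKind) (π : Equiv.Perm ℕ+) (A : Set ℕ∞) (t : ℕ) : ℕ∞ :=
  ({m : ℕ+ | (m : ℕ) ≤ t} ∩ leaders κ π A).encard

lemma leaderCount_mono (κ : PartKind) (π : Equiv.Perm ℕ+) (A : Set ℕ∞) :
    Monotone (leaderCount κ π A) := fun _ _ hst =>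
  Set.encard_le_encard (Set.inter_subset_inter_left _ fun _ hm => le_trans hm hst)

lemma leaderCount_le (κ : PartKind) (π : Equiv.Perm ℕ+) (A : Set ℕ∞) (t : ℕ) :
    leaderCount κ π A t ≤ t := by
  calc leaderCount κ π A t ≤ {m : ℕ+ | (m : ℕ) ≤ t}.encard :=
        Set.encard_le_encard Set.inter_subset_left
    _ = (PNat.val '' {m : ℕ+ | (m : ℕ) ≤ t}).encard := (PNat.coe_injective.encard_image _).symm
    _ ≤ (Set.Icc 1 t).encard := Set.encard_le_encard (by
        rintro _ ⟨m, hm, rfl⟩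
        exact ⟨m.pos, hm⟩)
    _ = t := by
        rw [← Finset.coe_Icc, Set.encard_coe_eq_coe_finsetCard]
        simp

/-- Each block contributes the leaders of its reduced permutation. -/
lemma leaderCount_add (κ : PartKind) (h : HasReducedBlock π a σ) (ha : SplitsNat π a)
    (hal : SplitsNat π (a + ℓ)) (A : Set ℕ∞) :
    leaderCount κ π A (a + ℓ) = leaderCount κ π A a + (leaders κ σ A).encard := by
  rw [leaderCount, leaderCount, ← (blockEmb_injective a ℓ).encard_image, ← Set.encard_union_eq]
  · congr 1
    ext x
    constructor
    · rintro ⟨hx, hxA⟩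
      rcases le_or_gt (x : ℕ) a with hxa | hxa
      · exact Or.inl ⟨hxa, hxA⟩
      · obtain ⟨i, rfl⟩ := exists_blockEmb_eq hxa hx
        exact Or.inr ⟨i, (blockEmb_mem_leaders κ h ha hal A i).1 hxA, rfl⟩
    · rintro (⟨hx, hxA⟩ | ⟨i, hi, rfl⟩)
      · exact ⟨le_trans hx (Nat.le_add_right _ _), hxA⟩
      · exact ⟨by simp only [Set.mem_ofPred_eq, blockEmb_val]; omega,
          (blockEmb_mem_leaders κ h ha hal A i).2 hi⟩
  · rw [Set.disjoint_left]
    rintro _ ⟨hx, -⟩ ⟨i, -, rfl⟩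
    simp only [Set.mem_ofPred_eq, blockEmb_val] at hx
    omega

/-- A part whose least element is at most a splitting time does not extend beyond that time. -/
lemma SplitsNat.partAt_le (κ : PartKind) (h : SplitsNat π a) {x y : ℕ+} (hx : (x : ℕ) ≤ a)
    (hy : y ∈ partAt κ π x) : (y : ℕ) ≤ a := by
  cases κ
  · obtain ⟨z, rfl⟩ := hy
    -- neither `π` nor its inverse leaves `{1, …, a}`
    have hpow : ∀ (n : ℕ) (w : ℕ+), (w : ℕ) ≤ a ↔ ((π ^ n) w : ℕ) ≤ a := by
      intro n
      induction n with
      | zero => simp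
      | succ n ih =>
        intro w
        rw [pow_succ, Equiv.Perm.mul_apply, ← ih]
        exact ⟨h w, fun hw => not_lt.1 fun hlt => absurd (h.lt_apply hlt) (not_lt.2 hw)⟩
    obtain ⟨n, rfl | rfl⟩ := z.eq_nat_or_neg
    · rw [zpow_natCast]
      exact (hpow n x).1 hx
    · rw [hpow n, zpow_neg, zpow_natCast, Equiv.Perm.coe_inv, Equiv.apply_symm_apply]
      exact hx
  · have h0 : 0 < a := lt_of_lt_of_le x.pos hx
    exact (hy ⟨a, h0⟩ fun w hw => h w hw).2 hx

/-- The number of parts of `π` with length in `A` wholly contained in `[n]`. -/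
noncomputable def containedCount (κ : PartKind) (π : Equiv.Perm ℕ+) (A : Set ℕ∞) (n : ℕ+) : ℕ∞ :=
  {c ∈ parts κ π | c.encard ∈ A ∧ c ⊆ Set.Iic n}.encard

lemma encard_parts_least_le_eq (κ : PartKind) (π : Equiv.Perm ℕ+) (A : Set ℕ∞) (n : ℕ) :
    {c ∈ parts κ π | c.encard ∈ A ∧ ∃ m : ℕ+, (m : ℕ) ≤ n ∧ IsLeast c m}.encard =
      leaderCount κ π A n :=
  encard_parts_isLeast_mem κ π A {m : ℕ+ | (m : ℕ) ≤ n}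

lemma containedCount_le (κ : PartKind) (π : Equiv.Perm ℕ+) (A : Set ℕ∞) (n : ℕ+) :
    containedCount κ π A n ≤ leaderCount κ π A n := by
  rw [← encard_parts_least_le_eq]
  refine Set.encard_le_encard ?_
  rintro _ ⟨⟨x, rfl⟩, hA, hn⟩
  obtain ⟨m, hm⟩ := exists_isLeast_partAt κ π x
  exact ⟨⟨x, rfl⟩, hA, m, hn hm.1, hm⟩

lemma leaderCount_le_containedCount (κ : PartKind) (ha : SplitsNat π a) (A : Set ℕ∞) {n : ℕ+}
    (han : a ≤ n) : leaderCount κ π A a ≤ containedCount κ π A n := by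
  rw [← encard_parts_least_le_eq]
  refine Set.encard_le_encard ?_
  rintro _ ⟨⟨x, rfl⟩, hA, m, hma, hm⟩
  refine ⟨⟨x, rfl⟩, hA, fun y hy => ?_⟩
  rw [← partAt_eq_of_mem hm.1] at hy
  exact PNat.coe_le_coe _ _ |>.1 ((ha.partAt_le κ hma hy).trans han)

lemma insideCount_eq (κ : PartKind) (π : Equiv.Perm ℕ+) (n j : ℕ+) :
    insideCount κ π n j = containedCount κ π {((j : ℕ) : ℕ∞)} n := rfl

lemma insideTotal_eq (κ : PartKind) (π : Equiv.Perm ℕ+) (n : ℕ+) :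
    insideTotal κ π n = containedCount κ π Set.univ n := by
  simp [insideTotal, containedCount]

lemma leastCount_eq (κ : PartKind) (π : Equiv.Perm ℕ+) (n j : ℕ+) :
    leastCount κ π n j = leaderCount κ π {((j : ℕ) : ℕ∞)} n :=
  encard_parts_least_le_eq κ π {((j : ℕ) : ℕ∞)} n

lemma leastTotal_eq (κ : PartKind) (π : Equiv.Perm ℕ+) (n : ℕ+) :
    leastTotal κ π n = leaderCount κ π Set.univ n := by
  rw [← encard_parts_least_le_eq]
  simp [leastTotal]

end Block

/-! ### Independence of the reduced blocks -/

section CountableIndep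

variable {Ω β γ : Type*} [MeasurableSpace Ω] {P : Measure Ω} [IsProbabilityMeasure P]
  [MeasurableSpace β] [MeasurableSpace γ] [Countable β]
  [MeasurableSingletonClass β] [MeasurableSingletonClass γ]

/-- If the joint law of `F` and `G` is the law of `F` times a weight `w`, then `w` is the law of
`G`. The weight need not be known to have total mass `1`. -/
lemma measure_eq_of_joint_law {F : Ω → β} {G : Ω → γ} (hF : Measurable F) (hG : Measurable G)
    {w : γ → ℝ≥0∞} (h : ∀ x y, P {ω | F ω = x ∧ G ω = y} = P {ω | F ω = x} * w y) (y : γ) :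
    P {ω | G ω = y} = w y := by
  have hsplit : ∀ s : Set Ω, MeasurableSet s → P s = ∑' x, P {ω | F ω = x ∧ ω ∈ s} := by
    intro s hs
    rw [← measure_iUnion]
    · congr 1
      ext ω
      simp
    · intro x x' hxx'
      rw [Function.onFun, Set.disjoint_left]
      rintro ω ⟨h1, -⟩ ⟨h2, -⟩
      exact hxx' (h1.symm.trans h2)
    · exact fun x => (hF (measurableSet_singleton x)).inter hs
  have h1 : ∑' x, P {ω | F ω = x} = 1 := by
    have := hsplit Set.univ MeasurableSet.univ
    simpa using this.symm
  have h2 := hsplit {ω | G ω = y} (hG (measurableSet_singleton y))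
  rw [h2]
  simp only [Set.mem_ofPred_eq, h]
  rw [ENNReal.tsum_mul_right, h1, one_mul]

/-- Countably valued random variables whose joint law has product form are independent. -/
lemma indepFun_of_joint_law [Countable γ] {F : Ω → β} {G : Ω → γ} (hF : Measurable F)
    (hG : Measurable G) {w : γ → ℝ≥0∞} (h : ∀ x y, P {ω | F ω = x ∧ G ω = y} = P {ω | F ω = x} * w y) :
    IndepFun F G P := by
  rw [indepFun_iff_map_prod_eq_prod_map_map hF.aemeasurable hG.aemeasurable]
  refine Measure.ext_of_singleton fun ⟨x, y⟩ => ?_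
  rw [Measure.map_apply (hF.prodMk hG) (measurableSet_singleton _), ← Set.singleton_prod_singleton,
    Measure.prod_prod, Measure.map_apply hF (measurableSet_singleton _),
    Measure.map_apply hG (measurableSet_singleton _)]
  have hy := measure_eq_of_joint_law hF hG h y
  have hset : (fun ω => (F ω, G ω)) ⁻¹' ({x} ×ˢ {y}) = {ω | F ω = x ∧ G ω = y} := by
    ext ω
    simp
  rw [hset, h x y, ← hy]
  rfl

end CountableIndep

/-- A block: its length and its reduced permutation. -/
abbrev Block : Type := Σ ℓ : ℕ+, Equiv.Perm (Fin (ℓ : ℕ))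

instance : MeasurableSpace Block := ⊤

instance : DiscreteMeasurableSpace Block := ⟨fun _ => trivial⟩

open Classical in
/-- The block of length `ℓ` of `π` that starts after `a`, with the identity as reduced permutation
if `π` does not preserve `{a + 1, …, a + ℓ}`. -/
noncomputable def reducedBlock (π : Equiv.Perm ℕ+) (a : ℕ) (ℓ : ℕ+) : Block :=
  ⟨ℓ, if h : ∃ σ : Equiv.Perm (Fin (ℓ : ℕ)), HasReducedBlock π a σ then h.choose else 1⟩

lemma reducedBlock_hasReducedBlock {π : Equiv.Perm ℕ+} {a : ℕ} {ℓ : ℕ+}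
    (h : ∃ σ : Equiv.Perm (Fin (ℓ : ℕ)), HasReducedBlock π a σ) :
    HasReducedBlock π a (reducedBlock π a ℓ).2 := by
  simp only [reducedBlock, dif_pos h]
  exact h.choose_spec

lemma reducedBlock_eq_iff {π : Equiv.Perm ℕ+} {a : ℕ} {ℓ : ℕ+}
    (h : ∃ σ : Equiv.Perm (Fin (ℓ : ℕ)), HasReducedBlock π a σ) (b : Block) :
    reducedBlock π a ℓ = b ↔ ℓ = b.1 ∧ HasReducedBlock π a b.2 := by
  constructor
  · rintro rfl
    exact ⟨rfl, reducedBlock_hasReducedBlock h⟩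
  · obtain ⟨ℓ', τ⟩ := b
    rintro ⟨h1, h2⟩
    dsimp only at h1 h2
    subst h1
    exact Sigma.ext rfl (heq_of_eq ((reducedBlock_hasReducedBlock h).unique h2))

/-- The `k`-th block of the regenerative permutation `X`, counted from `0` and not counting the
initial block `[T₀]`. -/
noncomputable def nthBlock {Ω : Type*} (X : Ω → Equiv.Perm ℕ+) (T₀ : Ω → ℕ) (Y : ℕ → Ω → ℕ+)
    (k : ℕ) (ω : Ω) : Block :=
  reducedBlock (X ω) (renewalTime T₀ Y k ω) (Y k ω)

/-- The probability that a generic block equals `b`. -/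
noncomputable def blockWeight (p : PMF ℕ+) (Q : ∀ ℓ : ℕ+, PMF (Equiv.Perm (Fin (ℓ : ℕ))))
    (b : Block) : ℝ≥0∞ :=
  p b.1 * Q b.1 b.2

section RenewalTime

variable {Ω : Type*} (T₀ : Ω → ℕ) (Y : ℕ → Ω → ℕ+) (ω : Ω)

lemma renewalTime_succ (k : ℕ) :
    renewalTime T₀ Y (k + 1) ω = renewalTime T₀ Y k ω + Y k ω := by
  rw [renewalTime, renewalTime, Finset.sum_range_succ, add_assoc]

lemma renewalTime_zero : renewalTime T₀ Y 0 ω = T₀ ω := by simp [renewalTime]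

lemma strictMono_renewalTime : StrictMono fun k => renewalTime T₀ Y k ω :=
  strictMono_nat_of_lt_succ fun k => by
    rw [renewalTime_succ]
    exact Nat.lt_add_of_pos_right (Y k ω).pos

/-- A point of the `k`-th block lies in no other block. -/
lemma renewalTime_index_unique {k k' n : ℕ} (h1 : renewalTime T₀ Y k ω < n)
    (h2 : n ≤ renewalTime T₀ Y (k + 1) ω) (h1' : renewalTime T₀ Y k' ω < n)
    (h2' : n ≤ renewalTime T₀ Y (k' + 1) ω) : k = k' := by
  have hm := strictMono_renewalTime T₀ Y ω
  have ha := hm.lt_iff_lt.1 (h1.trans_le h2')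
  have hb := hm.lt_iff_lt.1 (h1'.trans_le h2)
  omega

lemma exists_renewalTime_lt_le {n : ℕ} (hn : T₀ ω < n) :
    ∃ k, renewalTime T₀ Y k ω < n ∧ n ≤ renewalTime T₀ Y (k + 1) ω := by
  classical
  have hm := strictMono_renewalTime T₀ Y ω
  have hex : ∃ k, n ≤ renewalTime T₀ Y k ω := ⟨n, hm.le_apply⟩
  have hpos : Nat.find hex ≠ 0 := by
    intro h0
    have := Nat.find_spec hex
    rw [h0, renewalTime_zero] at this
    omega
  obtain ⟨k, hk⟩ := Nat.exists_eq_succ_of_ne_zero hpos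
  refine ⟨k, not_le.1 (Nat.find_min hex (by omega)), ?_⟩
  have := Nat.find_spec hex
  rwa [hk] at this

lemma exists_hasReducedBlock_renewalTime {X : Ω → Equiv.Perm ℕ+} {T₀ : Ω → ℕ} {Y : ℕ → Ω → ℕ+}
    {ω : Ω} (hω : ∀ k, SplitsNat (X ω) (renewalTime T₀ Y k ω)) (k : ℕ) :
    ∃ σ : Equiv.Perm (Fin (Y k ω : ℕ)), HasReducedBlock (X ω) (renewalTime T₀ Y k ω) σ :=
  exists_hasReducedBlock (hω k) (by rw [← renewalTime_succ]; exact hω (k + 1))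

end RenewalTime

namespace IsRecurrentRegenerative

variable {Ω : Type*} [MeasurableSpace Ω] {P : Measure Ω}
  {X : Ω → Equiv.Perm ℕ+} {T₀ : Ω → ℕ} {Y : ℕ → Ω → ℕ+} {p : PMF ℕ+}
  {Q : ∀ ℓ : ℕ+, PMF (Equiv.Perm (Fin (ℓ : ℕ)))}

lemma measurable_renewalTime (hX : IsRecurrentRegenerative P X T₀ Y p Q) (k : ℕ) :
    Measurable (renewalTime T₀ Y k) :=
  hX.measurable_delay.add (Finset.measurable_fun_sum _ fun i _ => hX.measurable_length i)

lemma measurableSet_length_eq (hX : IsRecurrentRegenerative P X T₀ Y p Q) (k : ℕ) (ℓ : ℕ+) :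
    MeasurableSet {ω | Y k ω = ℓ} := by
  have := hX.measurable_length k (measurableSet_singleton (ℓ : ℕ))
  convert this using 1
  ext ω
  simp [PNat.coe_inj]

lemma measurableSet_hasReducedBlock (hX : IsRecurrentRegenerative P X T₀ Y p Q) (k : ℕ) {ℓ : ℕ}
    (σ : Equiv.Perm (Fin ℓ)) :
    MeasurableSet {ω | HasReducedBlock (X ω) (renewalTime T₀ Y k ω) σ} := by
  have : {ω | HasReducedBlock (X ω) (renewalTime T₀ Y k ω) σ} =
      ⋃ a : ℕ, {ω | renewalTime T₀ Y k ω = a} ∩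
        ⋂ i : Fin ℓ, {ω | (X ω (Nat.succPNat (a + i)) : ℕ) = a + (σ i : ℕ) + 1} := by
    ext ω
    simp [HasReducedBlock]
  rw [this]
  refine MeasurableSet.iUnion fun a => MeasurableSet.inter ?_ (MeasurableSet.iInter fun i => ?_)
  · exact hX.measurable_renewalTime k (measurableSet_singleton a)
  · exact hX.measurable_perm _ (measurableSet_singleton (a + (σ i : ℕ) + 1))

lemma measurable_nthBlock (hX : IsRecurrentRegenerative P X T₀ Y p Q) (k : ℕ) :
    Measurable (nthBlock X T₀ Y k) := by
  refine measurable_to_countable' fun ⟨ℓ, σ⟩ => ?_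
  -- the second alternative covers the default value of `reducedBlock`
  have : nthBlock X T₀ Y k ⁻¹' {⟨ℓ, σ⟩} = {ω | Y k ω = ℓ} ∩
      ({ω | HasReducedBlock (X ω) (renewalTime T₀ Y k ω) σ} ∪
        ({_ω | σ = 1} ∩ ⋂ τ : Equiv.Perm (Fin (ℓ : ℕ)),
          {ω | HasReducedBlock (X ω) (renewalTime T₀ Y k ω) τ}ᶜ)) := by
    ext ω
    simp only [Set.mem_preimage, Set.mem_singleton_iff, Set.mem_inter_iff, Set.mem_union,
      Set.mem_iInter, Set.mem_compl_iff, Set.mem_ofPred_eq, nthBlock]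
    by_cases h : ∃ τ : Equiv.Perm (Fin (Y k ω : ℕ)),
        HasReducedBlock (X ω) (renewalTime T₀ Y k ω) τ
    · rw [reducedBlock_eq_iff h]
      refine and_congr_right fun hl => ?_
      dsimp only at hl
      subst hl
      refine ⟨Or.inl, fun h' => h'.resolve_right fun h'' => ?_⟩
      obtain ⟨τ, hτ⟩ := h
      exact h''.2 τ hτ
    · constructor
      · intro he
        simp only [reducedBlock, dif_neg h] at he
        obtain ⟨rfl, he⟩ := Sigma.mk.inj_iff.1 he
        exact ⟨rfl, Or.inr ⟨(eq_of_heq he).symm, fun τ hτ => h ⟨τ, hτ⟩⟩⟩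
      · rintro ⟨rfl, h1 | ⟨rfl, -⟩⟩
        · exact absurd ⟨σ, h1⟩ h
        · simp only [reducedBlock, dif_neg h]
  rw [this]
  refine (hX.measurableSet_length_eq k ℓ).inter
    ((hX.measurableSet_hasReducedBlock k σ).union (MeasurableSet.inter (MeasurableSet.const _)
      (MeasurableSet.iInter fun τ => (hX.measurableSet_hasReducedBlock k τ).compl)))

lemma ae_splitsNat (hX : IsRecurrentRegenerative P X T₀ Y p Q) :
    ∀ᵐ ω ∂P, ∀ k, SplitsNat (X ω) (renewalTime T₀ Y k ω) := hX.splits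

/-- The delay and the first `k` blocks, which together determine the `k`-th renewal time. -/
noncomputable def past (X : Ω → Equiv.Perm ℕ+) (T₀ : Ω → ℕ) (Y : ℕ → Ω → ℕ+) (k : ℕ) (ω : Ω) :
    ℕ × (Fin k → Block) :=
  (T₀ ω, fun i => nthBlock X T₀ Y i ω)

lemma measurable_past (hX : IsRecurrentRegenerative P X T₀ Y p Q) (k : ℕ) :
    Measurable (past X T₀ Y k) :=
  hX.measurable_delay.prodMk (measurable_pi_lambda _ fun i => hX.measurable_nthBlock i)

/-- The delay and the successive blocks are independent, and the blocks have the law given by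
`blockWeight`. -/
lemma measure_delay_blocks (hX : IsRecurrentRegenerative P X T₀ Y p Q) (m t : ℕ)
    (b : Fin m → Block) :
    P {ω | T₀ ω = t ∧ ∀ k : Fin m, nthBlock X T₀ Y k ω = b k} =
      P {ω | T₀ ω = t} * ∏ k : Fin m, blockWeight p Q (b k) := by
  have h1 : P {ω | T₀ ω = t ∧ ∀ k : Fin m, nthBlock X T₀ Y k ω = b k} =
      P {ω | T₀ ω = t ∧ ∀ k : Fin m, Y k ω = (b k).1 ∧
        HasReducedBlock (X ω) (renewalTime T₀ Y k ω) (b k).2} := by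
    refine measure_congr ?_
    filter_upwards [hX.ae_splitsNat] with ω hω
    refine propext (and_congr_right fun _ => forall_congr' fun k => ?_)
    exact reducedBlock_eq_iff (exists_hasReducedBlock_renewalTime hω k) (b k)
  have h2 : P {ω | T₀ ω = t ∧ ∀ k : Fin m, Y k ω = (b k).1} =
      P {ω | T₀ ω = t} * P {ω | ∀ k : Fin m, Y k ω = (b k).1} := by
    have hms : MeasurableSet {y : ℕ → ℕ | ∀ k : Fin m, y k = (b k).1} := by
      rw [Set.ofPred_forall]
      exact MeasurableSet.iInter fun k =>
        (measurableSet_singleton ((b k).1 : ℕ)).preimage (measurable_pi_apply (k : ℕ))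
    have := hX.indep_delay.measure_inter_preimage_eq_mul {t} _ (measurableSet_singleton t) hms
    simp only [Set.preimage_ofPred_eq, PNat.coe_inj] at this
    exact this
  have h3 : P {ω | ∀ k : Fin m, Y k ω = (b k).1} = ∏ k : Fin m, p (b k).1 := by
    have hind : iIndepFun (fun (k : Fin m) ω => (Y k ω : ℕ)) P :=
      hX.indep_lengths.precomp Fin.val_injective
    have := hind.measure_inter_preimage_eq_mul Finset.univ (sets := fun k => {((b k).1 : ℕ)})
      (fun k _ => measurableSet_singleton _)
    convert this using 1
    · congr 1
      ext ω
      simp [PNat.coe_inj]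
    · refine Finset.prod_congr rfl fun k _ => ?_
      rw [← hX.length_law k]
      congr 1
      ext ω
      simp [PNat.coe_inj]
  rw [h1, hX.block_law, h2, h3, mul_assoc, ← Finset.prod_mul_distrib]
  rfl

/-- Each block is independent of the past, with the law given by `blockWeight`. -/
lemma measure_past_nthBlock (hX : IsRecurrentRegenerative P X T₀ Y p Q) (k : ℕ)
    (x : ℕ × (Fin k → Block)) (b : Block) :
    P {ω | past X T₀ Y k ω = x ∧ nthBlock X T₀ Y k ω = b} =
      P {ω | past X T₀ Y k ω = x} * blockWeight p Q b := by
  have h1 := hX.measure_delay_blocks (k + 1) x.1 (Fin.snoc x.2 b)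
  have h2 := hX.measure_delay_blocks k x.1 x.2
  rw [Fin.prod_univ_castSucc] at h1
  simp only [Fin.snoc_castSucc, Fin.snoc_last] at h1
  rw [← mul_assoc, ← h2] at h1
  convert h1 using 2
  · ext ω
    simp [Fin.forall_fin_succ', past, Prod.ext_iff, funext_iff, and_assoc]
  · congr 1
    ext ω
    simp [past, Prod.ext_iff, funext_iff]

variable [IsProbabilityMeasure P]

lemma measure_nthBlock_eq (hX : IsRecurrentRegenerative P X T₀ Y p Q) (k : ℕ) (b : Block) :
    P {ω | nthBlock X T₀ Y k ω = b} = blockWeight p Q b :=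
  measure_eq_of_joint_law (hX.measurable_past k) (hX.measurable_nthBlock k)
    (hX.measure_past_nthBlock k) b

lemma indepFun_past (hX : IsRecurrentRegenerative P X T₀ Y p Q) (k : ℕ) :
    IndepFun (past X T₀ Y k) (nthBlock X T₀ Y k) P :=
  indepFun_of_joint_law (hX.measurable_past k) (hX.measurable_nthBlock k)
    (hX.measure_past_nthBlock k)

lemma indepFun_renewalTime (hX : IsRecurrentRegenerative P X T₀ Y p Q) (k : ℕ) :
    IndepFun (renewalTime T₀ Y k) (nthBlock X T₀ Y k) P := by
  have h := (hX.indepFun_past k).comp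
    (φ := fun x : ℕ × (Fin k → Block) => x.1 + ∑ i, ((x.2 i).1 : ℕ)) (ψ := id)
    (measurable_of_countable _) measurable_id
  convert h using 1
  swap
  · rfl
  funext ω
  simp only [renewalTime, Function.comp, past, nthBlock, reducedBlock]
  rw [Finset.sum_range fun i => (Y i ω : ℕ)]

lemma pairwise_indepFun_nthBlock (hX : IsRecurrentRegenerative P X T₀ Y p Q) :
    Pairwise fun i k => IndepFun (nthBlock X T₀ Y i) (nthBlock X T₀ Y k) P := by
  have key : ∀ i k, i < k → IndepFun (nthBlock X T₀ Y i) (nthBlock X T₀ Y k) P := by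
    intro i k hik
    exact (hX.indepFun_past k).comp (φ := fun x : ℕ × (Fin k → Block) => x.2 ⟨i, hik⟩) (ψ := id)
      (measurable_of_countable _) measurable_id
  intro i k hik
  rcases lt_or_gt_of_ne hik with h | h
  · exact key i k h
  · exact (key k i h).symm

lemma identDistrib_nthBlock (hX : IsRecurrentRegenerative P X T₀ Y p Q) (i k : ℕ) :
    IdentDistrib (nthBlock X T₀ Y i) (nthBlock X T₀ Y k) P P where
  aemeasurable_fst := (hX.measurable_nthBlock i).aemeasurable
  aemeasurable_snd := (hX.measurable_nthBlock k).aemeasurable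
  map_eq := by
    refine Measure.ext_of_singleton fun b => ?_
    rw [Measure.map_apply (hX.measurable_nthBlock i) (measurableSet_singleton b),
      Measure.map_apply (hX.measurable_nthBlock k) (measurableSet_singleton b)]
    exact (hX.measure_nthBlock_eq i b).trans (hX.measure_nthBlock_eq k b).symm

/-- Expectation of a function of a block. -/
lemma lintegral_nthBlock (hX : IsRecurrentRegenerative P X T₀ Y p Q) (k : ℕ) (g : Block → ℝ≥0∞) :
    ∫⁻ ω, g (nthBlock X T₀ Y k ω) ∂P = ∑' b, blockWeight p Q b * g b := by
  rw [← lintegral_map (f := g) (measurable_of_countable g) (hX.measurable_nthBlock k),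
    lintegral_countable']
  refine tsum_congr fun b => ?_
  rw [Measure.map_apply (hX.measurable_nthBlock k) (measurableSet_singleton b), mul_comm]
  congr 1
  exact hX.measure_nthBlock_eq k b

end IsRecurrentRegenerative

/-! ### Renewal limits -/

/-- The blocks that have a point in position `m`, with that point satisfying `φ`. -/
def blocksWith (φ : ∀ b : Block, Fin (b.1 : ℕ) → Prop) (m : ℕ) : Set Block :=
  {b | ∃ h : m < (b.1 : ℕ), φ b ⟨m, h⟩}

/-- The event that `n` lies outside the initial block, in a block where its position satisfies
`φ`. -/
def pointEvent {Ω : Type*} (X : Ω → Equiv.Perm ℕ+) (T₀ : Ω → ℕ) (Y : ℕ → Ω → ℕ+)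
    (φ : ∀ b : Block, Fin (b.1 : ℕ) → Prop) (n : ℕ) : Set Ω :=
  {ω | ∃ k, ∃ i : Fin (nthBlock X T₀ Y k ω).1,
    renewalTime T₀ Y k ω + i + 1 = n ∧ φ (nthBlock X T₀ Y k ω) i}

lemma tsum_blockWeight_mul (p : PMF ℕ+) (Q : ∀ ℓ : ℕ+, PMF (Equiv.Perm (Fin (ℓ : ℕ))))
    (g : Block → ℝ≥0∞) : ∑' b, blockWeight p Q b * g b =
      ∑' ℓ : ℕ+, p ℓ * ∑ σ : Equiv.Perm (Fin (ℓ : ℕ)), Q ℓ σ * g ⟨ℓ, σ⟩ := by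
  rw [ENNReal.tsum_sigma']
  refine tsum_congr fun ℓ => ?_
  rw [tsum_fintype, Finset.mul_sum]
  exact Finset.sum_congr rfl fun σ _ => by rw [blockWeight, mul_assoc]

lemma sum_PMF_coe {α : Type*} [Fintype α] (q : PMF α) : ∑ a, q a = 1 := by
  rw [← tsum_fintype (L := .unconditional _), q.tsum_coe]

lemma tsum_blockWeight_mul_length (p : PMF ℕ+)
    (Q : ∀ ℓ : ℕ+, PMF (Equiv.Perm (Fin (ℓ : ℕ)))) :
    ∑' b : Block, blockWeight p Q b * ((b.1 : ℕ) : ℝ≥0∞) = meanLength p := by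
  rw [tsum_blockWeight_mul p Q fun b => ((b.1 : ℕ) : ℝ≥0∞), meanLength]
  refine tsum_congr fun ℓ => ?_
  dsimp only
  rw [← Finset.sum_mul, sum_PMF_coe, one_mul, mul_comm]

lemma tsum_blockWeight (p : PMF ℕ+) (Q : ∀ ℓ : ℕ+, PMF (Equiv.Perm (Fin (ℓ : ℕ)))) :
    ∑' b : Block, blockWeight p Q b = 1 := by
  have h := tsum_blockWeight_mul p Q fun _ => 1
  simp only [mul_one, sum_PMF_coe, p.tsum_coe] at h
  exact h

lemma meanLength_ne_zero (p : PMF ℕ+) : meanLength p ≠ 0 := by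
  obtain ⟨ℓ, hℓ⟩ := p.support_nonempty
  intro h
  have := ENNReal.tsum_eq_zero.1 h ℓ
  simp only [mul_eq_zero, Nat.cast_eq_zero, PNat.ne_zero, false_or] at this
  exact (p.mem_support_iff ℓ).1 hℓ this

lemma encard_fin_setOf_le {ℓ : ℕ} (s : Set (Fin ℓ)) : s.encard ≤ ℓ := by
  calc s.encard ≤ (Set.univ : Set (Fin ℓ)).encard := Set.encard_le_encard (Set.subset_univ s)
    _ = ℓ := by simp

/-- The number of positions in `b` satisfying `φ`, counted position by position. -/
lemma tsum_indicator_blocksWith (φ : ∀ b : Block, Fin (b.1 : ℕ) → Prop) (b : Block) :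
    ∑' m, (blocksWith φ m).indicator (fun _ => (1 : ℝ≥0∞)) b = ({i | φ b i}.encard : ℝ≥0∞) := by
  have h : {i | φ b i}.encard = {m | b ∈ blocksWith φ m}.encard := by
    rw [← Fin.val_injective.encard_image]
    congr 1
    ext m
    constructor
    · rintro ⟨i, hi, rfl⟩
      exact ⟨i.2, hi⟩
    · rintro ⟨h, hm⟩
      exact ⟨⟨m, h⟩, hm, rfl⟩
  rw [h, ← ENNReal.tsum_set_one, tsum_subtype {m | b ∈ blocksWith φ m} fun _ => (1 : ℝ≥0∞)]
  rfl

/-- Every point after the initial block lies in some block. -/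
lemma pointEvent_true {Ω : Type*} {X : Ω → Equiv.Perm ℕ+} {T₀ : Ω → ℕ} {Y : ℕ → Ω → ℕ+} (n : ℕ) :
    pointEvent X T₀ Y (fun _ _ => True) n = {ω | T₀ ω < n} := by
  ext ω
  simp only [pointEvent, and_true, Set.mem_ofPred_eq]
  constructor
  · rintro ⟨k, i, h⟩
    have := (strictMono_renewalTime T₀ Y ω).monotone (Nat.zero_le k)
    simp only [renewalTime_zero] at this
    omega
  · intro h
    obtain ⟨k, h1, h2⟩ := exists_renewalTime_lt_le T₀ Y ω h
    rw [renewalTime_succ] at h2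
    exact ⟨k, ⟨n - renewalTime T₀ Y k ω - 1, show _ < (Y k ω : ℕ) by omega⟩,
      by dsimp only; omega⟩

namespace IsRecurrentRegenerative

variable {Ω : Type*} [MeasurableSpace Ω] {P : Measure Ω}
  {X : Ω → Equiv.Perm ℕ+} {T₀ : Ω → ℕ} {Y : ℕ → Ω → ℕ+} {p : PMF ℕ+}
  {Q : ∀ ℓ : ℕ+, PMF (Equiv.Perm (Fin (ℓ : ℕ)))}

lemma measurableSet_exists_renewalTime_block (hX : IsRecurrentRegenerative P X T₀ Y p Q) (a : ℕ)
    (A : Set Block) :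
    MeasurableSet {ω | ∃ k, renewalTime T₀ Y k ω = a ∧ nthBlock X T₀ Y k ω ∈ A} := by
  rw [Set.ofPred_exists]
  exact MeasurableSet.iUnion fun k =>
    (hX.measurable_renewalTime k (measurableSet_singleton a)).inter
      (hX.measurable_nthBlock k (MeasurableSet.of_discrete (s := A)))

lemma measure_blocksWith_last (hX : IsRecurrentRegenerative P X T₀ Y p Q) (ℓ : ℕ+) :
    P {ω | nthBlock X T₀ Y 0 ω ∈ blocksWith (fun b i => (i : ℕ) + 1 = b.1) (ℓ - 1)} = p ℓ := by
  rw [← hX.length_law 0 ℓ]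
  congr 1
  ext ω
  have := ℓ.pos
  simp only [blocksWith, nthBlock, reducedBlock, Set.mem_ofPred_eq, ← PNat.coe_inj]
  constructor
  · rintro ⟨_, h⟩
    omega
  · intro h
    exact ⟨by omega, by omega⟩

/-- The renewal equation of the delayed renewal process: a renewal at `n` is the initial one or the
end of a block. -/
lemma measure_renewal_eq (hX : IsRecurrentRegenerative P X T₀ Y p Q) (n : ℕ) :
    P {ω | ∃ k, renewalTime T₀ Y k ω = n} = P {ω | T₀ ω = n} +
      P (pointEvent X T₀ Y (fun b i => (i : ℕ) + 1 = b.1) n) := by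
  have hset : {ω | ∃ k, renewalTime T₀ Y k ω = n} = {ω | T₀ ω = n} ∪
      pointEvent X T₀ Y (fun b i => (i : ℕ) + 1 = b.1) n := by
    ext ω
    simp only [pointEvent, Set.mem_ofPred_eq, Set.mem_union]
    constructor
    · rintro ⟨k, hk⟩
      cases k with
      | zero => exact Or.inl (by rw [← hk, renewalTime_zero])
      | succ k =>
        rw [renewalTime_succ] at hk
        have hpos := (Y k ω).pos
        refine Or.inr ⟨k, ⟨Y k ω - 1, show _ < (Y k ω : ℕ) by omega⟩, ?_, ?_⟩
        · dsimp only
          omega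
        · change (Y k ω : ℕ) - 1 + 1 = Y k ω
          omega
    · rintro (h | ⟨k, i, h, hi⟩)
      · exact ⟨0, by rw [renewalTime_zero, h]⟩
      · refine ⟨k + 1, ?_⟩
        change (i : ℕ) + 1 = Y k ω at hi
        rw [renewalTime_succ]
        omega
  have hm : MeasurableSet {ω | T₀ ω = n} := hX.measurable_delay (measurableSet_singleton n)
  rw [hset, measure_union' _ hm]
  rw [Set.disjoint_left]
  rintro ω h ⟨k, i, h', -⟩
  have := (strictMono_renewalTime T₀ Y ω).monotone (Nat.zero_le k)
  simp only [renewalTime_zero] at this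
  have h'' : T₀ ω = n := h
  omega

variable [IsProbabilityMeasure P]

/-- The block that starts at a renewal time is independent of the event that there is a renewal
there. -/
lemma measure_exists_renewalTime_block (hX : IsRecurrentRegenerative P X T₀ Y p Q) (a : ℕ)
    (A : Set Block) :
    P {ω | ∃ k, renewalTime T₀ Y k ω = a ∧ nthBlock X T₀ Y k ω ∈ A} =
      P {ω | ∃ k, renewalTime T₀ Y k ω = a} * P {ω | nthBlock X T₀ Y 0 ω ∈ A} := by
  have hA : MeasurableSet A := MeasurableSet.of_discrete
  have hdisj : Pairwise (Function.onFun Disjoint fun k => {ω | renewalTime T₀ Y k ω = a}) := by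
    intro k k' hkk'
    rw [Function.onFun, Set.disjoint_left]
    intro ω h h'
    exact hkk' ((strictMono_renewalTime T₀ Y ω).injective (h.trans h'.symm))
  have hmeas : ∀ k, MeasurableSet {ω | renewalTime T₀ Y k ω = a} := fun k =>
    hX.measurable_renewalTime k (measurableSet_singleton a)
  rw [Set.ofPred_exists, Set.ofPred_exists, measure_iUnion hdisj hmeas, measure_iUnion,
    ← ENNReal.tsum_mul_right]
  · refine tsum_congr fun k => ?_
    have h1 := (hX.indepFun_renewalTime k).measure_inter_preimage_eq_mul {a} A
      (measurableSet_singleton a) hA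
    have h2 := (hX.identDistrib_nthBlock k 0).measure_mem_eq hA
    rw [h2] at h1
    exact h1
  · intro k k' hkk'
    exact (hdisj hkk').mono (fun ω h => h.1) (fun ω h => h.1)
  · exact fun k => (hmeas k).inter (hX.measurable_nthBlock k hA)

/-- Decomposition of a point event according to the position of `n` in its block. -/
lemma measure_pointEvent (hX : IsRecurrentRegenerative P X T₀ Y p Q)
    (φ : ∀ b : Block, Fin (b.1 : ℕ) → Prop) (n : ℕ) :
    P (pointEvent X T₀ Y φ n) = ∑ m ∈ Finset.range n,
      P {ω | ∃ k, renewalTime T₀ Y k ω = n - 1 - m} *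
        P {ω | nthBlock X T₀ Y 0 ω ∈ blocksWith φ m} := by
  have hset : pointEvent X T₀ Y φ n = ⋃ m ∈ Finset.range n,
      {ω | ∃ k, renewalTime T₀ Y k ω = n - 1 - m ∧ nthBlock X T₀ Y k ω ∈ blocksWith φ m} := by
    ext ω
    simp only [pointEvent, Set.mem_ofPred_eq, Set.mem_iUnion, Finset.mem_range]
    constructor
    · rintro ⟨k, i, h, hi⟩
      exact ⟨i, by omega, k, by omega, i.2, hi⟩
    · rintro ⟨m, hm, k, hk, hlt, hφ⟩
      exact ⟨k, ⟨m, hlt⟩, by rw [hk]; dsimp only; omega, hφ⟩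
  rw [hset, measure_biUnion_finset]
  · exact Finset.sum_congr rfl fun m _ => hX.measure_exists_renewalTime_block _ _
  · intro m hm m' hm' hne
    rw [Function.onFun, Set.disjoint_left]
    rintro ω ⟨k, hk, hlt, -⟩ ⟨k', hk', hlt', -⟩
    have hm := Finset.mem_range.1 (Finset.mem_coe.1 hm)
    have hm' := Finset.mem_range.1 (Finset.mem_coe.1 hm')
    change m < (Y k ω : ℕ) at hlt
    change m' < (Y k' ω : ℕ) at hlt'
    have hkk' : k = k' := renewalTime_index_unique T₀ Y ω (n := n) (by omega)
      (by rw [renewalTime_succ]; omega) (by omega) (by rw [renewalTime_succ]; omega)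
    subst hkk'
    omega
  · exact fun m _ => hX.measurableSet_exists_renewalTime_block _ _

lemma tsum_measure_blocksWith (hX : IsRecurrentRegenerative P X T₀ Y p Q)
    (φ : ∀ b : Block, Fin (b.1 : ℕ) → Prop) :
    ∑' m, P {ω | nthBlock X T₀ Y 0 ω ∈ blocksWith φ m} =
      ∑' b, blockWeight p Q b * ({i | φ b i}.encard : ℝ≥0∞) := by
  simp only [← tsum_indicator_blocksWith, ← ENNReal.tsum_mul_left]
  rw [ENNReal.tsum_comm]
  refine tsum_congr fun m => ?_
  rw [← hX.lintegral_nthBlock 0]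
  have h : ∀ ω, (blocksWith φ m).indicator (fun _ => (1 : ℝ≥0∞)) (nthBlock X T₀ Y 0 ω) =
      {ω | nthBlock X T₀ Y 0 ω ∈ blocksWith φ m}.indicator 1 ω := fun ω => rfl
  simp only [h]
  rw [lintegral_indicator_one]
  exact hX.measurable_nthBlock 0 (MeasurableSet.of_discrete (s := blocksWith φ m))

lemma tsum_measure_blocksWith_le (hX : IsRecurrentRegenerative P X T₀ Y p Q)
    (φ : ∀ b : Block, Fin (b.1 : ℕ) → Prop) :
    ∑' m, P {ω | nthBlock X T₀ Y 0 ω ∈ blocksWith φ m} ≤ meanLength p := by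
  rw [hX.tsum_measure_blocksWith, ← tsum_blockWeight_mul_length p Q]
  refine ENNReal.tsum_le_tsum fun b => mul_le_mul_right ?_ _
  have := ENat.toENNReal_le.2 (encard_fin_setOf_le {i | φ b i})
  simpa using this

lemma tendsto_measure_delay_lt (P : Measure Ω) [IsProbabilityMeasure P] (T₀ : Ω → ℕ) :
    Tendsto (fun n : ℕ => P {ω | T₀ ω < n}) atTop (𝓝 1) := by
  have h := tendsto_measure_iUnion_atTop (μ := P) (s := fun n : ℕ => {ω | T₀ ω < n})
    (fun a b hab ω hω => lt_of_lt_of_le hω hab)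
  have hu : ⋃ n : ℕ, {ω | T₀ ω < n} = Set.univ :=
    Set.eq_univ_of_forall fun ω => Set.mem_iUnion.2 ⟨T₀ ω + 1, Nat.lt_succ_self _⟩
  rwa [hu, measure_univ] at h

lemma tendsto_measure_le_delay (hX : IsRecurrentRegenerative P X T₀ Y p Q) :
    Tendsto (fun n : ℕ => P {ω | n ≤ T₀ ω}) atTop (𝓝 0) := by
  have h := ENNReal.Tendsto.sub (tendsto_const_nhds (x := (1 : ℝ≥0∞)))
    (tendsto_measure_delay_lt P T₀) (Or.inl ENNReal.one_ne_top)
  rw [tsub_self] at h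
  refine h.congr fun n => ?_
  have hm : MeasurableSet {ω | T₀ ω < n} := hX.measurable_delay measurableSet_Iio
  rw [← prob_compl_eq_one_sub hm]
  congr 1
  ext ω
  simp

lemma measure_pointEvent_toReal (hX : IsRecurrentRegenerative P X T₀ Y p Q)
    (φ : ∀ b : Block, Fin (b.1 : ℕ) → Prop) (n : ℕ) :
    (P (pointEvent X T₀ Y φ n)).toReal = ∑ m ∈ Finset.range n,
      (P {ω | ∃ k, renewalTime T₀ Y k ω = n - 1 - m}).toReal *
        (P {ω | nthBlock X T₀ Y 0 ω ∈ blocksWith φ m}).toReal := by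
  rw [hX.measure_pointEvent, ENNReal.toReal_sum fun m _ =>
    ENNReal.mul_ne_top (measure_ne_top _ _) (measure_ne_top _ _)]
  exact Finset.sum_congr rfl fun m _ => ENNReal.toReal_mul

/-- The renewal theorem in terms of real numbers. -/
lemma tendsto_renewal_toReal (hX : IsRecurrentRegenerative P X T₀ Y p Q)
    (hμ : meanLength p ≠ ∞) (hp : Aperiodic p) :
    Tendsto (fun n : ℕ => (P {ω | ∃ k, renewalTime T₀ Y k ω = n}).toReal) atTop
      (𝓝 (meanLength p).toReal⁻¹) := by
  have hsummable : ∀ φ : ∀ b : Block, Fin (b.1 : ℕ) → Prop,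
      ∑' m, P {ω | nthBlock X T₀ Y 0 ω ∈ blocksWith φ m} ≠ ∞ := fun φ =>
    ne_top_of_le_ne_top hμ (hX.tsum_measure_blocksWith_le φ)
  have htrue : ∑' m, P {ω | nthBlock X T₀ Y 0 ω ∈ blocksWith (fun _ _ => True) m} =
      meanLength p := by
    rw [hX.tsum_measure_blocksWith, ← tsum_blockWeight_mul_length p Q]
    refine tsum_congr fun b => ?_
    simp
  have hlast : ∑' m, P {ω | nthBlock X T₀ Y 0 ω ∈
      blocksWith (fun b i => (i : ℕ) + 1 = b.1) m} = 1 := by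
    rw [hX.tsum_measure_blocksWith, ← tsum_blockWeight p Q]
    refine tsum_congr fun b => ?_
    have hs : {i : Fin (b.1 : ℕ) | (i : ℕ) + 1 = b.1} =
        {⟨b.1 - 1, Nat.sub_lt b.1.pos Nat.one_pos⟩} := by
      ext i
      have := b.1.pos
      simp only [Set.mem_ofPred_eq, Set.mem_singleton_iff, Fin.ext_iff]
      omega
    rw [hs, Set.encard_singleton]
    simp
  rw [← htrue, ENNReal.tsum_toReal_eq fun m => measure_ne_top _ _]
  refine tendsto_renewal
    (q := fun m => (P {ω | nthBlock X T₀ Y 0 ω ∈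
      blocksWith (fun b i => (i : ℕ) + 1 = b.1) m}).toReal)
    (fun n => ENNReal.toReal_nonneg) (fun n => measureReal_le_one)
    (fun m => ENNReal.toReal_nonneg) ?_ (fun m => ENNReal.toReal_nonneg)
    (ENNReal.summable_toReal (hsummable _)) ?_ ?_ ?_
  · have h := (ENNReal.summable_toReal (hsummable fun b i => (i : ℕ) + 1 = b.1)).hasSum
    rwa [← ENNReal.tsum_toReal_eq fun m => measure_ne_top _ _, hlast, ENNReal.toReal_one] at h
  · have h : Tendsto (fun n : ℕ => (P {ω | T₀ ω = n}).toReal) atTop (𝓝 0) := by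
      rw [← ENNReal.toReal_zero]
      refine (ENNReal.tendsto_toReal ENNReal.zero_ne_top).comp ?_
      exact tendsto_of_tendsto_of_tendsto_of_le_of_le tendsto_const_nhds
        hX.tendsto_measure_le_delay (fun _ => zero_le)
        (fun n => measure_mono fun ω hω => le_of_eq (Eq.symm hω))
    refine h.congr fun n => ?_
    rw [← hX.measure_pointEvent_toReal, hX.measure_renewal_eq n,
      ENNReal.toReal_add (measure_ne_top _ _) (measure_ne_top _ _), add_sub_cancel_right]
  · simp only [← hX.measure_pointEvent_toReal, pointEvent_true]
    rw [← ENNReal.toReal_one]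
    exact (ENNReal.tendsto_toReal ENNReal.one_ne_top).comp (tendsto_measure_delay_lt P T₀)
  · refine hp _ fun ℓ hℓ => Nat.setGcd_dvd_of_mem ⟨ℓ - 1, ?_, ?_⟩
    · have := ℓ.pos
      omega
    · rw [hX.measure_blocksWith_last ℓ]
      exact ENNReal.toReal_ne_zero.2 ⟨hℓ, p.apply_ne_top ℓ⟩

lemma tendsto_measure_renewal (hX : IsRecurrentRegenerative P X T₀ Y p Q)
    (hμ : meanLength p ≠ ∞) (hp : Aperiodic p) :
    Tendsto (fun n : ℕ => P {ω | ∃ k, renewalTime T₀ Y k ω = n}) atTop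
      (𝓝 (meanLength p)⁻¹) := by
  have h0 := meanLength_ne_zero p
  rw [← ENNReal.tendsto_toReal_iff (fun n => measure_ne_top _ _) (ENNReal.inv_ne_top.2 h0),
    ENNReal.toReal_inv]
  exact hX.tendsto_renewal_toReal hμ hp

/-- The key renewal theorem for point events: in the limit the position of `n` and its block are
distributed according to the size-biased law of a block. -/
lemma tendsto_measure_pointEvent (hX : IsRecurrentRegenerative P X T₀ Y p Q)
    (hμ : meanLength p ≠ ∞) (hp : Aperiodic p) (φ : ∀ b : Block, Fin (b.1 : ℕ) → Prop) :
    Tendsto (fun n : ℕ => P (pointEvent X T₀ Y φ n)) atTop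
      (𝓝 ((meanLength p)⁻¹ * ∑' b, blockWeight p Q b * ({i | φ b i}.encard : ℝ≥0∞))) := by
  have h0 := meanLength_ne_zero p
  have htop : ∑' m, P {ω | nthBlock X T₀ Y 0 ω ∈ blocksWith φ m} ≠ ∞ :=
    ne_top_of_le_ne_top hμ (hX.tsum_measure_blocksWith_le φ)
  rw [← hX.tsum_measure_blocksWith, ← ENNReal.tendsto_toReal_iff (fun n => measure_ne_top _ _)
    (ENNReal.mul_ne_top (ENNReal.inv_ne_top.2 h0) htop), ENNReal.toReal_mul, ENNReal.toReal_inv,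
    ENNReal.tsum_toReal_eq fun m => measure_ne_top _ _]
  simp only [hX.measure_pointEvent_toReal]
  exact tendsto_convolution_of_tendsto
    (u := fun n => (P {ω | ∃ k, renewalTime T₀ Y k ω = n}).toReal)
    (h := fun m => (P {ω | nthBlock X T₀ Y 0 ω ∈ blocksWith φ m}).toReal)
    (fun n => ENNReal.toReal_nonneg) (fun n => measureReal_le_one) (fun m => ENNReal.toReal_nonneg)
    (ENNReal.summable_toReal htop) (hX.tendsto_renewal_toReal hμ hp)

/-- The initial block and null sets do not affect the limit of a point event. -/
lemma tendsto_measure_of_ae_iff_pointEvent (hX : IsRecurrentRegenerative P X T₀ Y p Q)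
    (hμ : meanLength p ≠ ∞) (hp : Aperiodic p) (φ : ∀ b : Block, Fin (b.1 : ℕ) → Prop)
    {E : ℕ+ → Set Ω}
    (hE : ∀ᵐ ω ∂P, ∀ n : ℕ+, T₀ ω < n → (ω ∈ E n ↔ ω ∈ pointEvent X T₀ Y φ n)) :
    Tendsto (fun n : ℕ+ => P (E n)) atTop
      (𝓝 ((meanLength p)⁻¹ * ∑' b, blockWeight p Q b * ({i | φ b i}.encard : ℝ≥0∞))) := by
  have hval : Tendsto (fun n : ℕ+ => (n : ℕ)) atTop atTop := tendsto_PNat_val_atTop_atTop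
  have hlow := (hX.tendsto_measure_pointEvent hμ hp φ).comp hval
  have hupp := hlow.add (hX.tendsto_measure_le_delay.comp hval)
  rw [add_zero] at hupp
  refine tendsto_of_tendsto_of_tendsto_of_le_of_le hlow hupp (fun n => ?_) (fun n => ?_)
  · refine measure_mono_ae ?_
    filter_upwards [hE] with ω hω hn
    have hn' : ω ∈ pointEvent X T₀ Y (fun _ _ => True) n := by
      obtain ⟨k, i, h, -⟩ := hn
      exact ⟨k, i, h, trivial⟩
    rw [pointEvent_true] at hn'
    exact (hω n hn').2 hn
  · refine (measure_mono_ae ?_).trans (measure_union_le _ _)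
    filter_upwards [hE] with ω hω hn
    rcases lt_or_ge (T₀ ω) n with h | h
    · exact Or.inl ((hω n h).1 hn)
    · exact Or.inr h

end IsRecurrentRegenerative

/-! ### Expected numbers of parts in a generic block -/

/-- The expected number of parts of a generic block with length in `A`. -/
noncomputable def meanCount (κ : PartKind) (p : PMF ℕ+)
    (Q : ∀ ℓ : ℕ+, PMF (Equiv.Perm (Fin (ℓ : ℕ)))) (A : Set ℕ∞) : ℝ≥0∞ :=
  ∑' b : Block, blockWeight p Q b * ((leaders κ b.2 A).encard : ℝ≥0∞)

lemma toENNReal_encard_le (b : Block) (s : Set (Fin (b.1 : ℕ))) :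
    (s.encard : ℝ≥0∞) ≤ ((b.1 : ℕ) : ℝ≥0∞) := by
  simpa using ENat.toENNReal_le.2 (encard_fin_setOf_le s)

open Classical in
lemma toENNReal_encard_eq_sum {ℓ : ℕ} (s : Set (Fin ℓ)) :
    (s.encard : ℝ≥0∞) = ∑ i, if i ∈ s then 1 else 0 := by
  have h : s = ((Finset.univ.filter fun i => i ∈ s : Finset (Fin ℓ)) : Set (Fin ℓ)) := by
    ext
    simp
  rw [Finset.sum_boole]
  conv_lhs => rw [h, Set.encard_coe_eq_coe_finsetCard]
  simp

/-- The points of `s` are classified by the length of their part, which is positive and finite. -/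
lemma tsum_encard_partAt_encard_eq (κ : PartKind) {ℓ : ℕ} (σ : Equiv.Perm (Fin ℓ))
    (s : Set (Fin ℓ)) :
    ∑' j : ℕ+, ({i | i ∈ s ∧ (partAt κ σ i).encard = ((j : ℕ) : ℕ∞)}.encard : ℝ≥0∞) =
      (s.encard : ℝ≥0∞) := by
  classical
  simp only [toENNReal_encard_eq_sum, Set.mem_ofPred_eq]
  rw [Summable.tsum_finsetSum fun i _ => ENNReal.summable]
  refine Finset.sum_congr rfl fun i _ => ?_
  have hpos : 0 < (partAt κ σ i).ncard :=
    (Set.ncard_pos (Set.toFinite _)).2 ⟨i, mem_partAt_self κ σ i⟩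
  have hcard := (Set.toFinite (partAt κ σ i)).cast_ncard_eq
  rw [tsum_eq_single ⟨(partAt κ σ i).ncard, hpos⟩]
  · simp [hcard]
  · intro j hj
    refine if_neg fun h => hj (PNat.coe_injective ?_)
    rw [← hcard] at h
    exact (Nat.cast_injective h.2).symm

lemma meanCount_singleton (κ : PartKind) (p : PMF ℕ+)
    (Q : ∀ ℓ : ℕ+, PMF (Equiv.Perm (Fin (ℓ : ℕ)))) (j : ℕ+) :
    meanCount κ p Q {((j : ℕ) : ℕ∞)} = nu κ p Q j := by
  rw [meanCount, tsum_blockWeight_mul p Q fun b =>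
    ((leaders κ b.2 {((j : ℕ) : ℕ∞)}).encard : ℝ≥0∞), nu]
  simp only [blockCount_eq_encard_leaders]

lemma meanCount_univ (κ : PartKind) (p : PMF ℕ+)
    (Q : ∀ ℓ : ℕ+, PMF (Equiv.Perm (Fin (ℓ : ℕ)))) :
    meanCount κ p Q Set.univ = ∑' j : ℕ+, nu κ p Q j := by
  simp only [← meanCount_singleton, meanCount]
  rw [ENNReal.tsum_comm]
  refine tsum_congr fun b => ?_
  rw [ENNReal.tsum_mul_left, ← tsum_encard_partAt_encard_eq κ b.2]
  simp only [leaders, Set.mem_univ, and_true, Set.mem_ofPred_eq, Set.mem_singleton_iff]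

lemma meanCount_le (κ : PartKind) (p : PMF ℕ+)
    (Q : ∀ ℓ : ℕ+, PMF (Equiv.Perm (Fin (ℓ : ℕ)))) (A : Set ℕ∞) :
    meanCount κ p Q A ≤ meanLength p := by
  rw [← tsum_blockWeight_mul_length p Q]
  exact ENNReal.tsum_le_tsum fun b => mul_le_mul_right (toENNReal_encard_le b _) _

/-- The expected number of points of a generic block in parts of length `j`. -/
lemma tsum_blockWeight_mul_encard (κ : PartKind) (p : PMF ℕ+)
    (Q : ∀ ℓ : ℕ+, PMF (Equiv.Perm (Fin (ℓ : ℕ)))) (j : ℕ+) :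
    ∑' b : Block, blockWeight p Q b *
      ({i | (partAt κ b.2 i).encard = ((j : ℕ) : ℕ∞)}.encard : ℝ≥0∞) =
        ((j : ℕ) : ℝ≥0∞) * nu κ p Q j := by
  rw [← meanCount_singleton, meanCount, ← ENNReal.tsum_mul_left]
  refine tsum_congr fun b => ?_
  rw [encard_partAt_encard_eq, blockCount_eq_encard_leaders, ENat.toENNReal_mul, mul_left_comm]
  simp

/-- Every point of a block lies in a part of exactly one length. -/
lemma meanLength_eq_tsum_nu (κ : PartKind) (p : PMF ℕ+)
    (Q : ∀ ℓ : ℕ+, PMF (Equiv.Perm (Fin (ℓ : ℕ)))) :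
    meanLength p = ∑' j : ℕ+, ((j : ℕ) : ℝ≥0∞) * nu κ p Q j := by
  simp only [← tsum_blockWeight_mul_encard]
  rw [ENNReal.tsum_comm, ← tsum_blockWeight_mul_length p Q]
  refine tsum_congr fun b => ?_
  have h := tsum_encard_partAt_encard_eq κ b.2 Set.univ
  simp only [Set.mem_univ, true_and] at h
  rw [ENNReal.tsum_mul_left, h]
  simp

/-- Under the size-biased law of a block of length `ℓ`, the probability of length `j` is the
expected proportion of points in parts of length `j`. -/
lemma mul_sizeBiasedLength (κ : PartKind) {ℓ : ℕ+} (q : PMF (Equiv.Perm (Fin (ℓ : ℕ)))) (j : ℕ+) :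
    ((ℓ : ℕ) : ℝ≥0∞) * sizeBiasedLength κ q ((j : ℕ) : ℕ∞) =
      ∑ σ, q σ * ({i | (partAt κ σ i).encard = ((j : ℕ) : ℕ∞)}.encard : ℝ≥0∞) := by
  classical
  have hℓ : ((ℓ : ℕ) : ℝ≥0∞) ≠ 0 := by simp
  rw [sizeBiasedLength, PMF.bind_apply, tsum_fintype, Finset.mul_sum]
  refine Finset.sum_congr rfl fun σ _ => ?_
  rw [mul_left_comm, PMF.map_apply, tsum_fintype, Finset.mul_sum, toENNReal_encard_eq_sum]
  congr 1
  refine Finset.sum_congr rfl fun i _ => ?_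
  simp only [PMF.uniformOfFintype_apply, Fintype.card_fin, Set.mem_ofPred_eq,
    @eq_comm ℕ∞ ((j : ℕ) : ℕ∞)]
  split_ifs
  · exact ENNReal.mul_inv_cancel hℓ (ENNReal.natCast_ne_top _)
  · exact mul_zero _

lemma tsum_mul_sizeBiasedLength (κ : PartKind) (p : PMF ℕ+)
    (Q : ∀ ℓ : ℕ+, PMF (Equiv.Perm (Fin (ℓ : ℕ)))) (j : ℕ+) :
    ∑' ℓ : ℕ+, ((ℓ : ℕ) : ℝ≥0∞) * p ℓ * sizeBiasedLength κ (Q ℓ) ((j : ℕ) : ℕ∞) =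
      ((j : ℕ) : ℝ≥0∞) * nu κ p Q j := by
  rw [← tsum_blockWeight_mul_encard, tsum_blockWeight_mul p Q fun b =>
    ({i | (partAt κ b.2 i).encard = ((j : ℕ) : ℕ∞)}.encard : ℝ≥0∞)]
  refine tsum_congr fun ℓ => ?_
  rw [mul_comm _ (p ℓ), mul_assoc, mul_sizeBiasedLength]

lemma tsum_blockWeight_mul_encard_length (κ : PartKind) (p : PMF ℕ+)
    (Q : ∀ ℓ : ℕ+, PMF (Equiv.Perm (Fin (ℓ : ℕ)))) (j ℓ : ℕ+) :
    ∑' b : Block, blockWeight p Q b *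
      ({i | (partAt κ b.2 i).encard = ((j : ℕ) : ℕ∞) ∧ b.1 = ℓ}.encard : ℝ≥0∞) =
        ((ℓ : ℕ) : ℝ≥0∞) * p ℓ * sizeBiasedLength κ (Q ℓ) ((j : ℕ) : ℕ∞) := by
  rw [tsum_blockWeight_mul p Q fun b =>
    ({i | (partAt κ b.2 i).encard = ((j : ℕ) : ℕ∞) ∧ b.1 = ℓ}.encard : ℝ≥0∞),
    tsum_eq_single ℓ]
  · rw [mul_comm _ (p ℓ), mul_assoc, mul_sizeBiasedLength]
    simp
  · intro ℓ' hℓ'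
    simp [hℓ']

/-- The relation between `s` and `ν` determines a probability distribution `s` uniquely, because
it says that `s` is proportional to `ν`. -/
lemma eq_normalization_iff {s ν : ℕ+ → ℝ≥0∞} {M : ℝ≥0∞} (hM0 : M ≠ 0) (hM : M ≠ ∞)
    (hν : M = ∑' j : ℕ+, ((j : ℕ) : ℝ≥0∞) * ν j) (hV0 : ∑' j, ν j ≠ 0) (hV : ∑' j, ν j ≠ ∞) :
    (∑' j : ℕ+, s j = 1 ∧ ∀ j : ℕ+, s j = (∑' i : ℕ+, ((i : ℕ) : ℝ≥0∞) * s i) / M *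
      (1 / ((j : ℕ) : ℝ≥0∞)) * (((j : ℕ) : ℝ≥0∞) * ν j)) ↔ s = fun j => ν j / ∑' i, ν i := by
  have hcancel : ∀ (c : ℝ≥0∞) (j : ℕ+),
      c * (1 / ((j : ℕ) : ℝ≥0∞)) * (((j : ℕ) : ℝ≥0∞) * ν j) = c * ν j := by
    intro c j
    have hj : ((j : ℕ) : ℝ≥0∞) ≠ 0 := by simp
    rw [one_div, mul_assoc, ← mul_assoc _ _ (ν j),
      ENNReal.inv_mul_cancel hj (ENNReal.natCast_ne_top _), one_mul]
  simp only [hcancel]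
  constructor
  · rintro ⟨h1, h2⟩
    have h3 : (∑' i : ℕ+, ((i : ℕ) : ℝ≥0∞) * s i) / M * ∑' j, ν j = 1 := by
      rw [← ENNReal.tsum_mul_left, ← h1]
      exact tsum_congr fun j => (h2 j).symm
    have h4 := ENNReal.eq_inv_of_mul_eq_one_left h3
    funext j
    rw [h2 j, h4, mul_comm, div_eq_mul_inv]
  · rintro rfl
    simp only [div_eq_mul_inv]
    refine ⟨by rw [ENNReal.tsum_mul_right, ENNReal.mul_inv_cancel hV0 hV], fun j => ?_⟩
    have h5 : ∑' i : ℕ+, ((i : ℕ) : ℝ≥0∞) * (ν i * (∑' i, ν i)⁻¹) = M * (∑' i, ν i)⁻¹ := by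
      rw [hν, ← ENNReal.tsum_mul_right]
      exact tsum_congr fun i => (mul_assoc _ _ _).symm
    rw [h5, mul_comm M, mul_assoc _ M M⁻¹, ENNReal.mul_inv_cancel hM0 hM, mul_one, mul_comm]

/-! ### Almost sure frequencies of parts -/

section Counting

variable {Ω : Type*} {X : Ω → Equiv.Perm ℕ+} {T₀ : Ω → ℕ} {Y : ℕ → Ω → ℕ+} {ω : Ω}

lemma leaderCount_renewalTime (κ : PartKind) (A : Set ℕ∞)
    (hω : ∀ k, SplitsNat (X ω) (renewalTime T₀ Y k ω)) (k : ℕ) :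
    leaderCount κ (X ω) A (renewalTime T₀ Y k ω) = leaderCount κ (X ω) A (T₀ ω) +
      ((∑ i ∈ Finset.range k, (leaders κ (nthBlock X T₀ Y i ω).2 A).ncard : ℕ) : ℕ∞) := by
  induction k with
  | zero => simp [renewalTime_zero]
  | succ k ih =>
    have hred := reducedBlock_hasReducedBlock (exists_hasReducedBlock_renewalTime hω k)
    have hsucc := hω (k + 1)
    rw [renewalTime_succ] at hsucc ⊢
    have hadd := leaderCount_add κ hred (hω k) hsucc A
    change leaderCount κ (X ω) A (renewalTime T₀ Y k ω + Y k ω) = _ at hadd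
    rw [hadd, ih, Finset.sum_range_succ, Nat.cast_add, ← add_assoc]
    congr 1
    exact (Set.toFinite _).cast_ncard_eq.symm

/-- Any count between the number of parts completed at the last renewal and the number of parts
begun has the frequency given by the laws of large numbers for the blocks. -/
lemma tendsto_count_div (κ : PartKind) (A : Set ℕ∞)
    (hω : ∀ k, SplitsNat (X ω) (renewalTime T₀ Y k ω)) {μ ν : ℝ} (hμ : 0 < μ)
    (hT : Tendsto (fun k : ℕ => (∑ i ∈ Finset.range k, ((Y i ω : ℕ) : ℝ)) / k) atTop (𝓝 μ))
    (hS : Tendsto (fun k : ℕ => (∑ i ∈ Finset.range k,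
      ((leaders κ (nthBlock X T₀ Y i ω).2 A).ncard : ℝ)) / k) atTop (𝓝 ν))
    {c : ℕ+ → ℕ∞}
    (hlow : ∀ (k : ℕ) (n : ℕ+), renewalTime T₀ Y k ω ≤ n →
      leaderCount κ (X ω) A (renewalTime T₀ Y k ω) ≤ c n)
    (hupp : ∀ n : ℕ+, c n ≤ leaderCount κ (X ω) A n) :
    Tendsto (fun n : ℕ+ => ((c n).toNat : ℝ) / (n : ℕ)) atTop (𝓝 (ν / μ)) := by
  have hcfin : ∀ n, c n ≠ ⊤ := fun n h => by
    have := (hupp n).trans (leaderCount_le κ (X ω) A n)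
    rw [h, top_le_iff] at this
    exact ENat.natCast_ne_top _ this
  have hT' : Tendsto (fun k : ℕ => (renewalTime T₀ Y k ω : ℝ) / k) atTop (𝓝 μ) := by
    have h := (tendsto_const_div_atTop_nhds_zero_nat (T₀ ω : ℝ)).add hT
    rw [zero_add] at h
    refine h.congr fun k => ?_
    rw [renewalTime, Nat.cast_add, Nat.cast_sum, add_div]
  have key := tendsto_div_of_renewal_bounds (T := fun k => renewalTime T₀ Y k ω)
    (S := fun k => ∑ i ∈ Finset.range k, ((leaders κ (nthBlock X T₀ Y i ω).2 A).ncard : ℝ))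
    (c := fun n => ((c n.toPNat').toNat : ℝ)) (C := (T₀ ω : ℝ))
    (strictMono_renewalTime T₀ Y ω) hμ hT' hS
    (fun k => Finset.sum_nonneg fun i _ => Nat.cast_nonneg _) (Nat.cast_nonneg _) ?_ ?_
  · refine (key.comp tendsto_PNat_val_atTop_atTop).congr fun n => ?_
    simp only [Function.comp, PNat.coe_toPNat']
  · intro k n hk
    have hn : n ≤ (n.toPNat' : ℕ) := by
      rw [Nat.toPNat'_coe]
      split_ifs <;> omega
    have h := hlow k n.toPNat' (hk.trans hn)
    rw [leaderCount_renewalTime κ A hω k] at h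
    have h2 := ENat.toNat_le_toNat (le_add_self.trans h) (hcfin _)
    rw [ENat.toNat_natCast] at h2
    exact_mod_cast h2
  · intro k n _ hk
    have hn : (n.toPNat' : ℕ) ≤ renewalTime T₀ Y (k + 1) ω := by
      rw [Nat.toPNat'_coe]
      split_ifs <;> omega
    have h := (hupp n.toPNat').trans (leaderCount_mono κ (X ω) A hn)
    rw [leaderCount_renewalTime κ A hω (k + 1)] at h
    have h2 := h.trans (add_le_add_left (leaderCount_le κ (X ω) A (T₀ ω)) _)
    rw [← Nat.cast_add] at h2
    have h3 := ENat.toNat_le_toNat h2 (ENat.natCast_ne_top _)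
    rw [ENat.toNat_natCast] at h3
    exact_mod_cast h3

end Counting

namespace IsRecurrentRegenerative

variable {Ω : Type*} [MeasurableSpace Ω] {P : Measure Ω} [IsProbabilityMeasure P]
  {X : Ω → Equiv.Perm ℕ+} {T₀ : Ω → ℕ} {Y : ℕ → Ω → ℕ+} {p : PMF ℕ+}
  {Q : ∀ ℓ : ℕ+, PMF (Equiv.Perm (Fin (ℓ : ℕ)))}

/-- The strong law of large numbers for a function of the blocks. -/
lemma ae_tendsto_average (hX : IsRecurrentRegenerative P X T₀ Y p Q) (g : Block → ℕ)
    (hg : ∑' b, blockWeight p Q b * (g b : ℝ≥0∞) ≠ ∞) :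
    ∀ᵐ ω ∂P, Tendsto (fun k : ℕ => (∑ i ∈ Finset.range k, (g (nthBlock X T₀ Y i ω) : ℝ)) / k)
      atTop (𝓝 (∑' b, blockWeight p Q b * (g b : ℝ≥0∞)).toReal) := by
  have hmeas : Measurable fun b : Block => (g b : ℝ) := measurable_of_countable _
  have hmeas' : Measurable fun ω => (g (nthBlock X T₀ Y 0 ω) : ℝ≥0∞) :=
    (measurable_of_countable fun b : Block => (g b : ℝ≥0∞)).comp (hX.measurable_nthBlock 0)
  have hint := hX.lintegral_nthBlock 0 fun b => (g b : ℝ≥0∞)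
  rw [← hint] at hg ⊢
  have h := strong_law_ae_real (μ := P) (fun i ω => (g (nthBlock X T₀ Y i ω) : ℝ)) ?_
    (fun i k hik => (hX.pairwise_indepFun_nthBlock hik).comp hmeas hmeas)
    (fun i => (hX.identDistrib_nthBlock i 0).comp hmeas)
  · have hE : ∫ ω, (g (nthBlock X T₀ Y 0 ω) : ℝ) ∂P =
        (∫⁻ ω, (g (nthBlock X T₀ Y 0 ω) : ℝ≥0∞) ∂P).toReal := by
      rw [← integral_toReal hmeas'.aemeasurable
        (Eventually.of_forall fun ω => ENNReal.natCast_lt_top _)]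
      simp
    rwa [hE] at h
  · have := integrable_toReal_of_lintegral_ne_top hmeas'.aemeasurable hg
    simpa using this

/-- Almost sure frequency of the parts with length in `A`, for every way of treating the parts that
straddle `n`. -/
lemma ae_tendsto_count_div (hX : IsRecurrentRegenerative P X T₀ Y p Q)
    (hμ : meanLength p ≠ ∞) (κ : PartKind) (A : Set ℕ∞) :
    ∀ᵐ ω ∂P, ∀ c : ℕ+ → ℕ∞,
      (∀ (k : ℕ) (n : ℕ+), renewalTime T₀ Y k ω ≤ n →
        leaderCount κ (X ω) A (renewalTime T₀ Y k ω) ≤ c n) →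
      (∀ n : ℕ+, c n ≤ leaderCount κ (X ω) A n) →
      Tendsto (fun n : ℕ+ => (c n : ℝ≥0∞) / ((n : ℕ) : ℝ≥0∞)) atTop
        (𝓝 (meanCount κ p Q A / meanLength p)) := by
  have hνtop : meanCount κ p Q A ≠ ∞ := ne_top_of_le_ne_top hμ (meanCount_le κ p Q A)
  have hμpos : 0 < (meanLength p).toReal := ENNReal.toReal_pos (meanLength_ne_zero p) hμ
  have hcount : ∑' b : Block, blockWeight p Q b * ((leaders κ b.2 A).ncard : ℝ≥0∞) =
      meanCount κ p Q A := by
    refine tsum_congr fun b => ?_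
    rw [← (Set.toFinite (leaders κ b.2 A)).cast_ncard_eq, ENat.toENNReal_coe]
  have h1 := hX.ae_tendsto_average (fun b => (b.1 : ℕ)) (by rwa [tsum_blockWeight_mul_length])
  have h2 := hX.ae_tendsto_average (fun b => (leaders κ b.2 A).ncard) (by rwa [hcount])
  rw [tsum_blockWeight_mul_length] at h1
  rw [hcount] at h2
  filter_upwards [hX.ae_splitsNat, h1, h2] with ω hω hT hS c hlow hupp
  have h := ENNReal.tendsto_ofReal (tendsto_count_div κ A hω hμpos hT hS hlow hupp)
  rw [ENNReal.ofReal_div_of_pos hμpos, ENNReal.ofReal_toReal hνtop, ENNReal.ofReal_toReal hμ] at h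
  refine h.congr fun n => ?_
  have hcfin : c n ≠ ⊤ := fun h => by
    have := (hupp n).trans (leaderCount_le κ (X ω) A n)
    rw [h, top_le_iff] at this
    exact ENat.natCast_ne_top _ this
  rw [ENNReal.ofReal_div_of_pos (by exact_mod_cast n.pos), ENNReal.ofReal_natCast,
    ENNReal.ofReal_natCast]
  conv_rhs => rw [← ENat.natCast_toNat hcfin]
  simp

lemma ae_tendsto_containedCount_div (hX : IsRecurrentRegenerative P X T₀ Y p Q)
    (hμ : meanLength p ≠ ∞) (κ : PartKind) (A : Set ℕ∞) :
    ∀ᵐ ω ∂P, Tendsto (fun n : ℕ+ => (containedCount κ (X ω) A n : ℝ≥0∞) / ((n : ℕ) : ℝ≥0∞)) atTop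
      (𝓝 (meanCount κ p Q A / meanLength p)) := by
  filter_upwards [hX.ae_splitsNat, hX.ae_tendsto_count_div hμ κ A] with ω hω h
  exact h _ (fun k n hk => leaderCount_le_containedCount κ (hω k) A hk)
    (fun n => containedCount_le κ (X ω) A n)

lemma ae_tendsto_leaderCount_div (hX : IsRecurrentRegenerative P X T₀ Y p Q)
    (hμ : meanLength p ≠ ∞) (κ : PartKind) (A : Set ℕ∞) :
    ∀ᵐ ω ∂P, Tendsto (fun n : ℕ+ => (leaderCount κ (X ω) A n : ℝ≥0∞) / ((n : ℕ) : ℝ≥0∞)) atTop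
      (𝓝 (meanCount κ p Q A / meanLength p)) := by
  filter_upwards [hX.ae_tendsto_count_div hμ κ A] with ω h
  exact h _ (fun k n hk => leaderCount_mono κ (X ω) A hk) (fun n => le_rfl)

end IsRecurrentRegenerative

/-! ### The part and the block containing a given point -/

section PointLaw

variable {Ω : Type*} {X : Ω → Equiv.Perm ℕ+} {T₀ : Ω → ℕ} {Y : ℕ → Ω → ℕ+} {ω : Ω}

lemma blockAt_encard {k : ℕ} {n : ℕ+} (h1 : renewalTime T₀ Y k ω < n)
    (h2 : (n : ℕ) ≤ renewalTime T₀ Y (k + 1) ω) :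
    (blockAt T₀ Y ω n).encard = ((Y k ω : ℕ) : ℕ∞) := by
  have hm := strictMono_renewalTime T₀ Y ω
  have hset : blockAt T₀ Y ω n =
      Set.range (blockEmb (renewalTime T₀ Y k ω) : Fin (Y k ω : ℕ) → ℕ+) := by
    ext x
    constructor
    · intro hx
      have hlt : renewalTime T₀ Y k ω < x := not_le.1 fun h => absurd ((hx k).1 h) (not_le.2 h1)
      have hle := (hx (k + 1)).2 h2
      rw [renewalTime_succ] at hle
      exact exists_blockEmb_eq hlt hle
    · rintro ⟨i, rfl⟩ k'
      rw [blockEmb_val]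
      rcases le_or_gt k' k with h | h
      · have := hm.monotone h
        omega
      · have := hm.monotone (Nat.succ_le_of_lt h)
        simp only [Nat.succ_eq_add_one, renewalTime_succ] at this h2
        have := i.2
        omega
  rw [hset, ← Set.image_univ, (blockEmb_injective _ _).encard_image]
  simp

/-- It suffices to translate an event at the position of `n` in its block. -/
lemma iff_pointEvent {φ : ∀ b : Block, Fin (b.1 : ℕ) → Prop} {n : ℕ} (hn : T₀ ω < n)
    {E : Prop} (h : ∀ (k : ℕ) (i : Fin (nthBlock X T₀ Y k ω).1),
      renewalTime T₀ Y k ω + i + 1 = n → (E ↔ φ (nthBlock X T₀ Y k ω) i)) :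
    E ↔ ω ∈ pointEvent X T₀ Y φ n := by
  constructor
  · intro hE
    have hn' : ω ∈ pointEvent X T₀ Y (fun _ _ => True) n := by rwa [pointEvent_true]
    obtain ⟨k, i, hki, -⟩ := hn'
    exact ⟨k, i, hki, (h k i hki).1 hE⟩
  · rintro ⟨k, i, hki, hφ⟩
    exact (h k i hki).2 hφ

lemma partAt_encard_eq (κ : PartKind)
    (hω : ∀ k, SplitsNat (X ω) (renewalTime T₀ Y k ω)) {k : ℕ} {n : ℕ+}
    (i : Fin (nthBlock X T₀ Y k ω).1) (h : renewalTime T₀ Y k ω + i + 1 = n) :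
    (partAt κ (X ω) n).encard = (partAt κ (nthBlock X T₀ Y k ω).2 i).encard := by
  have hn : n = blockEmb (renewalTime T₀ Y k ω) i := PNat.coe_injective h.symm
  have hsucc := hω (k + 1)
  rw [renewalTime_succ] at hsucc
  rw [hn]
  exact encard_partAt_blockEmb κ
    (reducedBlock_hasReducedBlock (exists_hasReducedBlock_renewalTime hω k)) (hω k) hsucc i

end PointLaw

namespace IsRecurrentRegenerative

variable {Ω : Type*} [MeasurableSpace Ω] {P : Measure Ω} [IsProbabilityMeasure P]
  {X : Ω → Equiv.Perm ℕ+} {T₀ : Ω → ℕ} {Y : ℕ → Ω → ℕ+} {p : PMF ℕ+}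
  {Q : ∀ ℓ : ℕ+, PMF (Equiv.Perm (Fin (ℓ : ℕ)))}

lemma tendsto_measure_partAt (hX : IsRecurrentRegenerative P X T₀ Y p Q)
    (hμ : meanLength p ≠ ∞) (hp : Aperiodic p) (κ : PartKind) (j : ℕ+) :
    Tendsto (fun n : ℕ+ => P {ω | (partAt κ (X ω) n).encard = ((j : ℕ) : ℕ∞)}) atTop
      (𝓝 (((j : ℕ) : ℝ≥0∞) * nu κ p Q j / meanLength p)) := by
  have h := hX.tendsto_measure_of_ae_iff_pointEvent hμ hp
    (fun b i => (partAt κ b.2 i).encard = ((j : ℕ) : ℕ∞))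
    (E := fun n => {ω | (partAt κ (X ω) n).encard = ((j : ℕ) : ℕ∞)}) ?_
  · rwa [tsum_blockWeight_mul_encard, mul_comm, ← div_eq_mul_inv] at h
  · filter_upwards [hX.ae_splitsNat] with ω hω n hn
    refine iff_pointEvent hn fun k i hki => ?_
    rw [partAt_encard_eq κ hω i hki]

lemma tendsto_measure_partAt_blockAt (hX : IsRecurrentRegenerative P X T₀ Y p Q)
    (hμ : meanLength p ≠ ∞) (hp : Aperiodic p) (κ : PartKind) (j ℓ : ℕ+) :
    Tendsto (fun n : ℕ+ => P {ω | (partAt κ (X ω) n).encard = ((j : ℕ) : ℕ∞) ∧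
        (blockAt T₀ Y ω n).encard = ((ℓ : ℕ) : ℕ∞)}) atTop
      (𝓝 (((ℓ : ℕ) : ℝ≥0∞) * p ℓ / meanLength p *
        sizeBiasedLength κ (Q ℓ) ((j : ℕ) : ℕ∞))) := by
  have h := hX.tendsto_measure_of_ae_iff_pointEvent hμ hp
    (fun b i => (partAt κ b.2 i).encard = ((j : ℕ) : ℕ∞) ∧ b.1 = ℓ)
    (E := fun n => {ω | (partAt κ (X ω) n).encard = ((j : ℕ) : ℕ∞) ∧
        (blockAt T₀ Y ω n).encard = ((ℓ : ℕ) : ℕ∞)}) ?_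
  · rwa [tsum_blockWeight_mul_encard_length, mul_comm, mul_right_comm, ← div_eq_mul_inv] at h
  · filter_upwards [hX.ae_splitsNat] with ω hω n hn
    refine iff_pointEvent hn fun k i hki => ?_
    have hi : (i : ℕ) < Y k ω := i.2
    rw [partAt_encard_eq κ hω i hki,
      blockAt_encard (k := k) (by omega) (by rw [renewalTime_succ]; omega), Nat.cast_inj,
      PNat.coe_inj]
    rfl

end IsRecurrentRegenerative

/-- Relative frequencies are quotients of frequencies. -/
lemma tendsto_ratio {a t : ℕ+ → ℝ≥0∞} {x y M : ℝ≥0∞} (hM0 : M ≠ 0) (hM : M ≠ ∞) (hy0 : y ≠ 0)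
    (hx : x ≠ ∞) (ha : Tendsto (fun n : ℕ+ => a n / ((n : ℕ) : ℝ≥0∞)) atTop (𝓝 (x / M)))
    (ht : Tendsto (fun n : ℕ+ => t n / ((n : ℕ) : ℝ≥0∞)) atTop (𝓝 (y / M))) :
    Tendsto (fun n => a n / t n) atTop (𝓝 (x / y)) := by
  have h := ENNReal.Tendsto.div ha (Or.inr (ENNReal.div_ne_zero.2 ⟨hy0, hM⟩)) ht
    (Or.inr (ENNReal.div_ne_top hx hM0))
  have hdiv : ∀ {b c d : ℝ≥0∞}, d ≠ 0 → d ≠ ∞ → b / d / (c / d) = b / c := fun {b c d} h0 h1 => by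
    rw [div_eq_mul_inv b, div_eq_mul_inv c,
      ENNReal.mul_div_mul_right _ _ (ENNReal.inv_ne_zero.2 h1) (ENNReal.inv_ne_top.2 h0)]
  rw [hdiv hM0 hM] at h
  exact h.congr fun n => hdiv (by simp) (ENNReal.natCast_ne_top _)

end RegenPerm

theorem mainTheorem7 {Ω : Type*} [MeasurableSpace Ω] (P : Measure Ω) [IsProbabilityMeasure P]
    (X : Ω → Equiv.Perm ℕ+) (T₀ : Ω → ℕ) (Y : ℕ → Ω → ℕ+) (p : PMF ℕ+)
    (Q : ∀ ℓ : ℕ+, PMF (Equiv.Perm (Fin (ℓ : ℕ))))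
    (hX : RegenPerm.IsRecurrentRegenerative P X T₀ Y p Q)
    (hμ : RegenPerm.meanLength p ≠ ∞) :
    -- convergence of the renewal probabilities
    (RegenPerm.Aperiodic p →
      Tendsto (fun n : ℕ+ => P {ω | ∃ k, RegenPerm.renewalTime T₀ Y k ω = (n : ℕ)}) atTop
        (𝓝 (1 / RegenPerm.meanLength p))) ∧
    -- the remaining statements, for cycles and for components
    ∀ κ : RegenPerm.PartKind,
      -- limiting frequencies of the counts
      (∀ᵐ ω ∂P, ∀ j : ℕ+,
        Tendsto (fun n : ℕ+ => (RegenPerm.insideCount κ (X ω) n j : ℝ≥0∞) / ((n : ℕ) : ℝ≥0∞)) atTop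
          (𝓝 (RegenPerm.nu κ p Q j / RegenPerm.meanLength p))) ∧
      (∀ᵐ ω ∂P, ∀ j : ℕ+,
        Tendsto (fun n : ℕ+ => (RegenPerm.leastCount κ (X ω) n j : ℝ≥0∞) / ((n : ℕ) : ℝ≥0∞)) atTop
          (𝓝 (RegenPerm.nu κ p Q j / RegenPerm.meanLength p))) ∧
      RegenPerm.meanLength p = ∑' j : ℕ+, ((j : ℕ) : ℝ≥0∞) * RegenPerm.nu κ p Q j ∧
      (RegenPerm.Aperiodic p →
        -- limiting distribution of the length of the part containing `n`
        (∀ j : ℕ+,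
          Tendsto (fun n : ℕ+ => P {ω | (RegenPerm.partAt κ (X ω) n).encard = ((j : ℕ) : ℕ∞)}) atTop
            (𝓝 (((j : ℕ) : ℝ≥0∞) * RegenPerm.nu κ p Q j / RegenPerm.meanLength p))) ∧
        (∀ j ℓ : ℕ+, j ≤ ℓ →
          Tendsto (fun n : ℕ+ => P {ω | (RegenPerm.partAt κ (X ω) n).encard = ((j : ℕ) : ℕ∞) ∧
              (RegenPerm.blockAt T₀ Y ω n).encard = ((ℓ : ℕ) : ℕ∞)}) atTop
            (𝓝 (((ℓ : ℕ) : ℝ≥0∞) * p ℓ / RegenPerm.meanLength p *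
              RegenPerm.sizeBiasedLength κ (Q ℓ) ((j : ℕ) : ℕ∞)))) ∧
        (∀ j : ℕ+,
          Tendsto (fun n : ℕ+ => P {ω | (RegenPerm.partAt κ (X ω) n).encard = ((j : ℕ) : ℕ∞)}) atTop
            (𝓝 (1 / RegenPerm.meanLength p * ∑' ℓ : ℕ+, ((ℓ : ℕ) : ℝ≥0∞) * p ℓ *
              RegenPerm.sizeBiasedLength κ (Q ℓ) ((j : ℕ) : ℕ∞)))) ∧
        -- relative frequencies
        ∃ r : ℕ+ → ℝ≥0∞,
          (∀ᵐ ω ∂P, ∀ j : ℕ+,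
            Tendsto (fun n : ℕ+ => (RegenPerm.insideCount κ (X ω) n j : ℝ≥0∞) /
              (RegenPerm.insideTotal κ (X ω) n : ℝ≥0∞)) atTop (𝓝 (r j))) ∧
          (∀ᵐ ω ∂P, ∀ j : ℕ+,
            Tendsto (fun n : ℕ+ => (RegenPerm.leastCount κ (X ω) n j : ℝ≥0∞) /
              (RegenPerm.leastTotal κ (X ω) n : ℝ≥0∞)) atTop (𝓝 (r j))) ∧
          (∀ j : ℕ+, r j = RegenPerm.nu κ p Q j / ∑' i : ℕ+, RegenPerm.nu κ p Q i) ∧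
          -- `r` is the only probability distribution that solves the second set of relations
          (∀ s : ℕ+ → ℝ≥0∞,
            (∑' j : ℕ+, s j = 1 ∧
              ∀ j : ℕ+, s j = (∑' i : ℕ+, ((i : ℕ) : ℝ≥0∞) * s i) / RegenPerm.meanLength p *
                (1 / ((j : ℕ) : ℝ≥0∞)) * ∑' ℓ : ℕ+, ((ℓ : ℕ) : ℝ≥0∞) * p ℓ *
                  RegenPerm.sizeBiasedLength κ (Q ℓ) ((j : ℕ) : ℕ∞)) ↔ s = r)) := by
  have hM0 := RegenPerm.meanLength_ne_zero p
  refine ⟨fun hp => ?_, fun κ => ?_⟩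
  · rw [one_div]
    exact (hX.tendsto_measure_renewal hμ hp).comp tendsto_PNat_val_atTop_atTop
  have hMν := RegenPerm.meanLength_eq_tsum_nu κ p Q
  have hV0 : ∑' i : ℕ+, RegenPerm.nu κ p Q i ≠ 0 := by
    intro h
    rw [ENNReal.tsum_eq_zero] at h
    refine hM0 ?_
    rw [hMν]
    simp [h]
  have hV : ∑' i : ℕ+, RegenPerm.nu κ p Q i ≠ ∞ := by
    rw [← RegenPerm.meanCount_univ]
    exact ne_top_of_le_ne_top hμ (RegenPerm.meanCount_le κ p Q _)
  have hνtop : ∀ j, RegenPerm.nu κ p Q j ≠ ∞ := fun j =>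
    ne_top_of_le_ne_top hV (ENNReal.le_tsum j)
  have hinside : ∀ᵐ ω ∂P, ∀ j : ℕ+,
      Tendsto (fun n : ℕ+ => (RegenPerm.insideCount κ (X ω) n j : ℝ≥0∞) / ((n : ℕ) : ℝ≥0∞)) atTop
        (𝓝 (RegenPerm.nu κ p Q j / RegenPerm.meanLength p)) := by
    refine ae_all_iff.2 fun j => ?_
    simp only [RegenPerm.insideCount_eq, ← RegenPerm.meanCount_singleton]
    exact hX.ae_tendsto_containedCount_div hμ κ _
  have hleast : ∀ᵐ ω ∂P, ∀ j : ℕ+,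
      Tendsto (fun n : ℕ+ => (RegenPerm.leastCount κ (X ω) n j : ℝ≥0∞) / ((n : ℕ) : ℝ≥0∞)) atTop
        (𝓝 (RegenPerm.nu κ p Q j / RegenPerm.meanLength p)) := by
    refine ae_all_iff.2 fun j => ?_
    simp only [RegenPerm.leastCount_eq, ← RegenPerm.meanCount_singleton]
    exact hX.ae_tendsto_leaderCount_div hμ κ _
  refine ⟨hinside, hleast, hMν, fun hp => ⟨hX.tendsto_measure_partAt hμ hp κ,
    fun j ℓ _ => hX.tendsto_measure_partAt_blockAt hμ hp κ j ℓ, fun j => ?_,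
    fun j => RegenPerm.nu κ p Q j / ∑' i : ℕ+, RegenPerm.nu κ p Q i, ?_, ?_, fun j => rfl, ?_⟩⟩
  · rw [RegenPerm.tsum_mul_sizeBiasedLength, one_div, mul_comm, ← div_eq_mul_inv]
    exact hX.tendsto_measure_partAt hμ hp κ j
  · have htotal := hX.ae_tendsto_containedCount_div hμ κ Set.univ
    simp only [← RegenPerm.insideTotal_eq, RegenPerm.meanCount_univ] at htotal
    filter_upwards [hinside, htotal] with ω h1 h2 j
    exact RegenPerm.tendsto_ratio hM0 hμ hV0 (hνtop j) (h1 j) h2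
  · have htotal := hX.ae_tendsto_leaderCount_div hμ κ Set.univ
    simp only [← RegenPerm.leastTotal_eq, RegenPerm.meanCount_univ] at htotal
    filter_upwards [hleast, htotal] with ω h1 h2 j
    exact RegenPerm.tendsto_ratio hM0 hμ hV0 (hνtop j) (h1 j) h2
  · intro s
    simp only [RegenPerm.tsum_mul_sizeBiasedLength]
    exact RegenPerm.eq_normalization_iff hM0 hμ hMν hV0 hV
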